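/- Let $q\in(2,\infty)$ and let $0<\lambda_1<\lambda_2<\cdots$ be an increasing sequence with $\lambda_k\to\infty$. Let $A$ be the diagonal operator on $\ell^q$, $Ae_k=\lambda_k e_k$, with its maximal domain $\{x\in\ell^q:(\lambda_kx_k)_k\in\ell^q\}$. Then: (1) On complex $\ell^q$, $A$ has a bounded $H^\infty$-calculus of angle zero. That is, $A$ is injective with dense range, $-A$ generates a bounded strongly continuous analytic semigroup, and $0$ is the infimum of the (nonempty) set of $\sigma\in(0,\pi)$ for which there are $\sigma_0\in(0,\min\{\sigma,\pi/2\})$ and $C\ge 0$ with the following properties. The operator $A$ is sectorial of angle at most $\sigma_0$, i.e. its spectrum is contained in the closure of $\Sigma_{\sigma_0}$, where $\Sigma_\theta=\{z\in\mathbb C\setminus\{0\}:|\arg z|<\theta\}$, and $z(z-A)^{-1}$ is uniformly bounded off $\Sigma_{\theta}$ for every $\theta\in(\sigma_0,\pi)$. Moreover $\|\varphi(A)\|\le C\sup_{\Sigma_\sigma}|\varphi|$ for every analytic $\varphi$ on $\Sigma_\sigma$ satisfying $|\varphi(z)|\le c\,|z|^\varepsilon(1+|z|^2)^{-\varepsilon}$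 for some $c,\varepsilon>0$, where $\varphi(A)=\frac1{2\pi i}\int_{\partial\Sigma_{\sigma'}}\varphi(z)(z-A)^{-1}\,dz$ with $\sigma'\in(\sigma_0,\sigma)$. (2) On real $\ell^q$, $-A$ generates a strongly continuous semigroup $(S(t))_{t\ge0}$, and stochastic maximal $L^2$-regularity fails for $A$, even for deterministic $G$ and a scalar Brownian motion: for every real-valued Brownian motion $W$ (continuity of paths is not needed) there is no constant $C$ such that $$\int_0^\infty \mathbb E\Big\|\int_0^t A^{1/2}S(t-s)G(s)\,dW(s)\Big\|_{\ell^q}^2\,dt\le C^2\int_0^\infty\|G(t)\|_{\ell^q}^2\,dt$$ for all $G\in L^2(\mathbb R_+;\ell^q)$; there is no such $C$ even if only those $G$ are considered for which the stochastic integral on the left exists for every $t>0$. Here $A^{1/2}$ is the square root of $A$, i.e. the closure of $x\mapsto\frac1\pi\int_0^\infty t^{-1/2}(t+A)^{-1}Ax\,dt$ on the domain of $A$, and the stochastic integral $\int_0^\infty F\,dW$ of $F:\mathbb R_+\to\ell^q$ is the limit in $L^2(\Omega;\ell^q)$ of the elementary integrals $\sum_i (W(b_i)-W(a_i))x_i$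 of step functions $\sum_i \mathbf 1_{(a_i,b_i]}x_i$ converging to $F$ in the norm $\big(\sum_k(\int_0^\infty|F_k(s)|^2\,ds)^{q/2}\big)^{1/q}$. -/

import Mathlib

open MeasureTheory ProbabilityTheory Filter Set
open scoped ENNReal NNReal Topology

noncomputable section

namespace StochMaxReg

/-! ### Unbounded operators: resolvents and semigroup generation -/

section Operators

variable {𝕜 E : Type*} [RCLike 𝕜] [NormedAddCommGroup E] [NormedSpace 𝕜 E]

/-- The bounded operator `R` is the two-sided inverse of `z - A : D(A) → E`. -/
def IsResolventAt (A : E →ₗ.[𝕜] E) (z : 𝕜) (R : E →L[𝕜] E) : Prop :=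
  (∀ x : E, ∃ h : R x ∈ A.domain, z • R x - A ⟨R x, h⟩ = x) ∧
    ∀ x : A.domain, R (z • (x : E) - A x) = x

/-- The resolvent set of an unbounded operator. -/
def resolventSet (A : E →ₗ.[𝕜] E) : Set 𝕜 := {z | ∃ R, IsResolventAt A z R}

open Classical in
/-- The resolvent `(z - A)⁻¹` (with the value `0` for `z` in the spectrum). -/
def resolventOp (A : E →ₗ.[𝕜] E) (z : 𝕜) : E →L[𝕜] E :=
  if h : ∃ R, IsResolventAt A z R then h.choose else 0

/-- `(S(t))_{t ≥ 0}` is a strongly continuous semigroup of bounded operators. The values at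
negative times are irrelevant. -/
structure IsC0Semigroup (S : ℝ → E →L[𝕜] E) : Prop where
  zero : S 0 = ContinuousLinearMap.id 𝕜 E
  add : ∀ s t : ℝ, 0 ≤ s → 0 ≤ t → S (s + t) = (S s).comp (S t)
  strongCont : ∀ x : E, ContinuousOn (fun t => S t x) (Ici 0)

/-- `S` is a strongly continuous semigroup whose generator is exactly `B`. -/
def Generates (B : E →ₗ.[𝕜] E) (S : ℝ → E →L[𝕜] E) : Prop :=
  IsC0Semigroup S ∧
    ∀ x y : E, (x, y) ∈ B.graph ↔
      Tendsto (fun h : ℝ => ((h : 𝕜)⁻¹) • (S h x - x)) (𝓝[>] 0) (𝓝 y)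

end Operators

/-! ### Bounded `H^∞`-calculus -/

section HInfty

variable {E : Type*} [NormedAddCommGroup E] [NormedSpace ℂ E]

/-- The open sector `Σ_σ = {z ≠ 0 : |arg z| < σ}`. -/
def sector (σ : ℝ) : Set ℂ := {z | z ≠ 0 ∧ |z.arg| < σ}

/-- The semigroup `S` extends to a bounded analytic semigroup on some sector. -/
def IsBoundedAnalytic (S : ℝ → E →L[ℂ] E) : Prop :=
  ∃ δ : ℝ, 0 < δ ∧ δ ≤ Real.pi / 2 ∧ ∃ T : ℂ → E →L[ℂ] E,
    DifferentiableOn ℂ T (sector δ) ∧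
    (∀ t : ℝ, 0 < t → T t = S t) ∧
    (∀ z ∈ sector δ, ∀ w ∈ sector δ, T (z + w) = (T z).comp (T w)) ∧
    (∃ M : ℝ, ∀ z ∈ sector δ, ‖T z‖ ≤ M) ∧
    ∀ x : E, Tendsto (fun z => T z x) (𝓝[sector δ] 0) (𝓝 x)

/-- The spectrum of `A` lies in the closure of `Σ_{σ₀}`, and `z (z - A)⁻¹` is uniformly bounded
off every larger sector. -/
def IsSectorial (A : E →ₗ.[ℂ] E) (σ₀ : ℝ) : Prop :=
  (resolventSet A)ᶜ ⊆ closure (sector σ₀) ∧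
    ∀ σ : ℝ, σ₀ < σ → σ < Real.pi →
      ∃ M : ℝ, ∀ z ∉ sector σ, ‖z • resolventOp A z‖ ≤ M

/-- The class `H^∞_0(Σ_σ)`: analytic functions `φ` on `Σ_σ` with
`|φ(z)| ≤ C |z|^ε / (1 + |z|²)^ε` for some `ε > 0`. -/
def IsHInftyZero (σ : ℝ) (φ : ℂ → ℂ) : Prop :=
  DifferentiableOn ℂ φ (sector σ) ∧
    ∃ C ε : ℝ, 0 < ε ∧ ∀ z ∈ sector σ, ‖φ z‖ ≤ C * ‖z‖ ^ ε / (1 + ‖z‖ ^ 2) ^ ε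

/-- The integral of `φ(z) (z - A)⁻¹` along the ray `{r e^{iθ} : r > 0}`, oriented outwards. -/
def rayIntegral (A : E →ₗ.[ℂ] E) (θ : ℝ) (φ : ℂ → ℂ) : E →L[ℂ] E :=
  ∫ r in Ioi (0 : ℝ),
    (φ (r * Complex.exp (θ * Complex.I)) * Complex.exp (θ * Complex.I)) •
      resolventOp A (r * Complex.exp (θ * Complex.I))

/-- `φ(A) = (2πi)⁻¹ ∫_{∂Σ_{σ'}} φ(z) (z - A)⁻¹ dz`; the boundary is positively oriented: outwards
along the ray of argument `-σ'`, inwards along the ray of argument `σ'`. -/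
def hInftyApply (A : E →ₗ.[ℂ] E) (σ' : ℝ) (φ : ℂ → ℂ) : E →L[ℂ] E :=
  (2 * (Real.pi : ℂ) * Complex.I)⁻¹ • (rayIntegral A (-σ') φ - rayIntegral A σ' φ)

/-- `A` has a bounded `H^∞(Σ_σ)`-calculus: `-A` generates a bounded strongly continuous analytic
semigroup, `A` is injective with dense range, `A` is sectorial of some angle
`σ₀ < min σ (π/2)`, and `‖φ(A)‖ ≤ C ‖φ‖_∞` for all `φ ∈ H^∞_0(Σ_σ)`. -/
structure HasBoundedHInftyCalculus (A : E →ₗ.[ℂ] E) (σ : ℝ) : Prop where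
  pos : 0 < σ
  lt_pi : σ < Real.pi
  generates : ∃ S : ℝ → E →L[ℂ] E, Generates (-A) S ∧ IsBoundedAnalytic S
  injective : ∀ x : A.domain, A x = 0 → x = 0
  denseRange : DenseRange fun x : A.domain => A x
  bound : ∃ σ₀ : ℝ, 0 < σ₀ ∧ σ₀ < σ ∧ σ₀ < Real.pi / 2 ∧ IsSectorial A σ₀ ∧
    ∃ C : ℝ, ∀ φ : ℂ → ℂ, IsHInftyZero σ φ → ∀ σ' : ℝ, σ₀ < σ' → σ' < σ →
      ‖hInftyApply A σ' φ‖ ≤ C * ⨆ z : sector σ, ‖φ z‖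

/-- `A` has a bounded `H^∞`-calculus of angle `ω`: the set of `σ` for which `A` has a bounded
`H^∞(Σ_σ)`-calculus is nonempty and has infimum `ω`. -/
def HasBoundedHInftyCalculusOfAngle (A : E →ₗ.[ℂ] E) (ω : ℝ) : Prop :=
  {σ : ℝ | HasBoundedHInftyCalculus A σ}.Nonempty ∧
    IsGLB {σ : ℝ | HasBoundedHInftyCalculus A σ} ω

end HInfty

/-! ### The square root -/

section SquareRoot

variable {E : Type*} [NormedAddCommGroup E] [NormedSpace ℝ E]

/-- The integrand `t^{-1/2} (t + A)⁻¹ A x` of Balakrishnan's formula;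
note `(t + A)⁻¹ = -(-t - A)⁻¹`. -/
def balakrishnanIntegrand (A : E →ₗ.[ℝ] E) (x : A.domain) (t : ℝ) : E :=
  t ^ (-(1 / 2) : ℝ) • (-(resolventOp A (-t)) (A x))

lemma balakrishnanIntegrand_add (A : E →ₗ.[ℝ] E) (x y : A.domain) :
    balakrishnanIntegrand A (x + y) =
      fun t => balakrishnanIntegrand A x t + balakrishnanIntegrand A y t := by
  funext t
  simp only [balakrishnanIntegrand, LinearPMap.map_add, map_add, neg_add, smul_add]

lemma balakrishnanIntegrand_smul (A : E →ₗ.[ℝ] E) (c : ℝ) (x : A.domain) :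
    balakrishnanIntegrand A (c • x) = fun t => c • balakrishnanIntegrand A x t := by
  funext t
  simp only [balakrishnanIntegrand, LinearPMap.map_smul, map_smul, smul_neg]
  rw [smul_comm]

lemma balakrishnanIntegrand_zero (A : E →ₗ.[ℝ] E) :
    balakrishnanIntegrand A 0 = fun _ => 0 := by
  funext t
  simp [balakrishnanIntegrand]

/-- The elements of `D(A)` for which Balakrishnan's integral converges absolutely (all of `D(A)`
for a sectorial `A`), as a submodule of `D(A)`. -/
def balakrishnanDomain (A : E →ₗ.[ℝ] E) : Submodule ℝ A.domain where
  carrier := {x | IntegrableOn (balakrishnanIntegrand A x) (Ioi 0)}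
  add_mem' {x y} hx hy := by
    simp only [mem_ofPred_eq] at hx hy ⊢
    rw [balakrishnanIntegrand_add]
    exact hx.add hy
  zero_mem' := by
    simp only [mem_ofPred_eq]
    rw [balakrishnanIntegrand_zero]
    exact integrableOn_zero
  smul_mem' c x hx := by
    simp only [mem_ofPred_eq] at hx ⊢
    rw [balakrishnanIntegrand_smul]
    exact hx.smul c

/-- `x ↦ π⁻¹ ∫₀^∞ t^{-1/2} (t + A)⁻¹ A x dt`. -/
def balakrishnanMap (A : E →ₗ.[ℝ] E) : balakrishnanDomain A →ₗ[ℝ] E where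
  toFun x := Real.pi⁻¹ • ∫ t in Ioi (0 : ℝ), balakrishnanIntegrand A x t
  map_add' x y := by
    rw [Submodule.coe_add, balakrishnanIntegrand_add, integral_add x.2 y.2, smul_add]
  map_smul' c x := by
    rw [Submodule.coe_smul, balakrishnanIntegrand_smul, integral_smul, RingHom.id_apply,
      smul_comm]

lemma mem_map_balakrishnanDomain (A : E →ₗ.[ℝ] E)
    (x : (balakrishnanDomain A).map A.domain.subtype) :
    ∃ h : (x : E) ∈ A.domain, (⟨x, h⟩ : A.domain) ∈ balakrishnanDomain A := by
  obtain ⟨y, hy, hyx⟩ := x.2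
  refine ⟨hyx ▸ y.2, ?_⟩
  have : (⟨(x : E), hyx ▸ y.2⟩ : A.domain) = y := Subtype.ext hyx.symm
  rw [this]
  exact hy

/-- The square root `A^{1/2}` of a sectorial operator: the closure of Balakrishnan's operator
`x ↦ π⁻¹ ∫₀^∞ t^{-1/2} (t + A)⁻¹ A x dt` on `D(A)`. -/
def sqrtOp (A : E →ₗ.[ℝ] E) : E →ₗ.[ℝ] E :=
  LinearPMap.closure
    { domain := (balakrishnanDomain A).map A.domain.subtype
      toFun :=
        { toFun := fun x =>
            balakrishnanMap A ⟨⟨x, (mem_map_balakrishnanDomain A x).1⟩,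
              (mem_map_balakrishnanDomain A x).2⟩
          map_add' := fun x y => by
            rw [← map_add]
            rfl
          map_smul' := fun c x => by
            rw [RingHom.id_apply, ← map_smul]
            rfl } }

open Classical in
/-- The value `B x`, with the value `0` outside `D(B)`. -/
def applyOrZero (B : E →ₗ.[ℝ] E) (x : E) : E := if h : x ∈ B.domain then B ⟨x, h⟩ else 0

/-- The integrand `s ↦ 1_{(0,t]}(s) A^{1/2} S(t-s) G(s)` of the stochastic convolution at
time `t`. -/
def convIntegrand (A : E →ₗ.[ℝ] E) (S : ℝ → E →L[ℝ] E) (G : ℝ → E) (t : ℝ) : ℝ → E :=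
  (Ioc 0 t).indicator fun s => applyOrZero (sqrtOp A) (S (t - s) (G s))

end SquareRoot

/-! ### The space `ℓ^q` and diagonal operators -/

/-- The sequence space `ℓ^q` over `𝕜`. -/
abbrev ell (𝕜 : Type*) [RCLike 𝕜] (q : ℝ≥0∞) : Type _ := lp (fun _ : ℕ => 𝕜) q

/-- The diagonal operator `A e_k = λ_k e_k` on `ℓ^q`, with its maximal domain
`{x ∈ ℓ^q : (λ_k x_k)_k ∈ ℓ^q}`. -/
def diagOp (𝕜 : Type*) [RCLike 𝕜] (q : ℝ≥0∞) [Fact (1 ≤ q)] (lam : ℕ → ℝ) :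
    ell 𝕜 q →ₗ.[𝕜] ell 𝕜 q where
  domain :=
    { carrier := {x | Memℓp (fun k => ((lam k : ℝ) : 𝕜) * x k) q}
      add_mem' := fun {x y} hx hy => by
        have := Memℓp.add hx hy
        simp only [mem_ofPred_eq, lp.coeFn_add, Pi.add_apply, mul_add]
        exact this
      zero_mem' := by
        simp only [mem_ofPred_eq, lp.coeFn_zero, Pi.zero_apply, mul_zero]
        exact zero_memℓp
      smul_mem' := fun c x hx => by
        have := Memℓp.const_smul hx c
        simp only [mem_ofPred_eq, lp.coeFn_smul, Pi.smul_apply, smul_eq_mul, mul_left_comm _ c]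
        exact this }
  toFun :=
    { toFun := fun x => ⟨fun k => ((lam k : ℝ) : 𝕜) * (x : ell 𝕜 q) k, x.2⟩
      map_add' := fun x y => by
        ext k
        exact mul_add _ _ _
      map_smul' := fun c x => by
        ext k
        exact mul_left_comm _ _ _ }

/-! ### The `ℓ^q`-valued stochastic integral of deterministic functions -/

section StochInt

variable {q : ℝ≥0∞} [Fact (1 ≤ q)] {Ω : Type*} [MeasurableSpace Ω]

/-- A deterministic step function `∑ᵢ 1_{(aᵢ, bᵢ]} xᵢ` on `[0, ∞)` with values in `E`. -/
structure StepFun (E : Type*) where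
  n : ℕ
  a : Fin n → ℝ≥0
  b : Fin n → ℝ≥0
  hab : ∀ i, a i < b i
  x : Fin n → E

/-- The function represented by a step function. -/
def StepFun.eval {E : Type*} [AddCommMonoid E] (Φ : StepFun E) (s : ℝ) : E :=
  ∑ i, (Ioc (Φ.a i : ℝ) (Φ.b i)).indicator (fun _ => Φ.x i) s

/-- The elementary stochastic integral `∑ᵢ (W(bᵢ) - W(aᵢ)) xᵢ`. -/
def StepFun.integral {E : Type*} [AddCommGroup E] [Module ℝ E] (Φ : StepFun E)
    (W : ℝ≥0 → Ω → ℝ) (ω : Ω) : E :=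
  ∑ i, (W (Φ.b i) ω - W (Φ.a i) ω) • Φ.x i

/-- The norm of `F` in `ℓ^q(L²(ℝ₊))`, `(∑_k (∫₀^∞ |F_k(s)|² ds)^{q/2})^{1/q}`,
for `q < ∞`. -/
def squareFunctionNorm (F : ℝ → ell ℝ q) : ℝ≥0∞ :=
  (∑' k, (∫⁻ s in Ioi (0 : ℝ), ‖F s k‖ₑ ^ 2) ^ (q.toReal / 2)) ^ (1 / q.toReal)

/-- `X` is (a version of) the stochastic integral `∫₀^∞ F dW`: there are step functions converging
to `F` in `ℓ^q(L²(ℝ₊))` whose elementary integrals converge to `X` in `L²(Ω; ℓ^q)`. -/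
def IsStochIntegral (W : ℝ≥0 → Ω → ℝ) (P : Measure Ω) (F : ℝ → ell ℝ q) (X : Ω → ell ℝ q) :
    Prop :=
  AEStronglyMeasurable F (volume.restrict (Ioi 0)) ∧ AEStronglyMeasurable X P ∧
    ∃ Φ : ℕ → StepFun (ell ℝ q),
      Tendsto (fun n => squareFunctionNorm fun s => F s - (Φ n).eval s) atTop (𝓝 0) ∧
      Tendsto (fun n => eLpNorm (fun ω => X ω - (Φ n).integral W ω) 2 P) atTop (𝓝 0)

/-- The stochastic integral `∫₀^∞ F dW` exists. -/
def StochIntegrable (W : ℝ≥0 → Ω → ℝ) (P : Measure Ω) (F : ℝ → ell ℝ q) : Prop :=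
  ∃ X, IsStochIntegral W P F X

open Classical in
/-- The stochastic integral `∫₀^∞ F dW`, unique up to almost sure equality (and `0` if it does
not exist). -/
def stochIntegral (W : ℝ≥0 → Ω → ℝ) (P : Measure Ω) (F : ℝ → ell ℝ q) : Ω → ell ℝ q :=
  if h : StochIntegrable W P F then h.choose else 0

end StochInt

end StochMaxReg

end

/-! Everything reduces to the coordinates of `ℓ^q`, where resolvents, semigroup and functional
calculus of `A` are multiplications by bounded sequences, with operator norm at most the supremum of
the multiplier.

Positive part. Cauchy's formula on a sector (`IsHInftyZero.cauchyRay_sub`) identifies `φ(A)` with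
multiplication by `φ(λ_k)`. As every `λ_k` lies in every sector, `‖φ(A)‖ ≤ sup |φ|` for each angle
`σ < π/2`, so the infimum of the admissible angles is `0`.

Negative part. Choose `N` indices `J` along which `λ` at least doubles, and a time `ε` below all
`1/λ_k`, `k ∈ J`. Test with `G = 1_{(0,ε]} ∑_{k ∈ J} e_k`, for which `∫ ‖G‖² ≤ ε N^{2/q}`. For `t ∈
(1/λ_k, 2/λ_k]` the `k`-th coordinate of the stochastic convolution has, by the Itô isometry,
variance `∫_0^ε λ_k e^{-2(t-s)λ_k} ds ≥ ε λ_k e^{-4}`; integrated over this window of length `1/λ_k`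
it contributes at least `ε e^{-4}`. Lacunarity makes the windows disjoint, so the contributions add
up to `N ε e^{-4}` (`card_mul_le_lintegral`). A constant `C` would therefore force `N^{1-2/q} ≤ C²
e^4` for all `N`, which is false for `q > 2`. The different coordinates are active at different
times, so the left side sees their `ℓ²`-sum and the right side only their `ℓ^q`-norm.

The test functions must also belong to the restricted class of `G` whose stochastic integrals exist
for all `t > 0`. Their integrands have finitely many nonzero coordinates and are Lipschitz on the
interval supporting them, so approximation by dyadic step functions suffices
(`stochIntegrable_indicator_of_lipschitz`). -/

noncomputable section

namespace StochMaxReg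

/-! ### Multiplication operators on `ℓ^q` -/

section Multipliers

variable {𝕜 : Type*} [RCLike 𝕜] {q : ℝ≥0∞}

/-- A bounded sequence, as a multiplier. -/
def IsMultiplier (m : ℕ → 𝕜) : Prop := ∃ M : ℝ, ∀ k, ‖m k‖ ≤ M

lemma memℓp_mul_of_le {m : ℕ → 𝕜} {M : ℝ} (hm : ∀ k, ‖m k‖ ≤ M) {x : ℕ → 𝕜}
    (hx : Memℓp x q) : Memℓp (fun k => m k * x k) q := by
  refine (hx.const_smul (M : 𝕜)).mono' fun k => ?_
  have h0 : 0 ≤ M := (norm_nonneg _).trans (hm k)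
  simp only [norm_mul, Pi.smul_apply, smul_eq_mul, RCLike.norm_ofReal, abs_of_nonneg h0]
  gcongr
  exact hm k

lemma IsMultiplier.memℓp {m : ℕ → 𝕜} (hm : IsMultiplier m) {x : ℕ → 𝕜} (hx : Memℓp x q) :
    Memℓp (fun k => m k * x k) q :=
  let ⟨_, hM⟩ := hm
  memℓp_mul_of_le hM hx

variable [Fact (1 ≤ q)]

lemma exponent_ne_zero : q ≠ 0 :=
  (zero_lt_one.trans_le (Fact.out : 1 ≤ q)).ne'

lemma exponent_toReal_pos (hq : q < ∞) : 0 < q.toReal :=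
  ENNReal.toReal_pos exponent_ne_zero hq.ne

lemma norm_mul_le_of_forall_le {m : ℕ → 𝕜} {M : ℝ} (hm : ∀ k, ‖m k‖ ≤ M) (x y : ell 𝕜 q)
    (hy : ∀ k, y k = m k * x k) : ‖y‖ ≤ M * ‖x‖ := by
  have h0 : 0 ≤ M := (norm_nonneg _).trans (hm 0)
  have h : ‖y‖ ≤ ‖(M : 𝕜) • x‖ := by
    refine lp.norm_mono exponent_ne_zero fun k => ?_
    rw [hy, lp.coeFn_smul, Pi.smul_apply, smul_eq_mul, norm_mul, norm_mul, RCLike.norm_ofReal,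
      abs_of_nonneg h0]
    gcongr
    exact hm k
  rwa [norm_smul, RCLike.norm_ofReal, abs_of_nonneg h0] at h

open Classical in
/-- The operator of multiplication by a bounded sequence on `ℓ^q` (and `0` for an unbounded
sequence). -/
def mulCLM (q : ℝ≥0∞) [Fact (1 ≤ q)] (m : ℕ → 𝕜) : ell 𝕜 q →L[𝕜] ell 𝕜 q :=
  if hm : IsMultiplier m then
    LinearMap.mkContinuous
      { toFun := fun x => ⟨fun k => m k * x k, hm.memℓp x.2⟩
        map_add' := fun x y => by
          ext k
          exact mul_add _ _ _
        map_smul' := fun c x => by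
          ext k
          exact mul_left_comm _ _ _ }
      hm.choose fun x => norm_mul_le_of_forall_le hm.choose_spec _ _ fun _ => rfl
  else 0

lemma mulCLM_apply {m : ℕ → 𝕜} (hm : IsMultiplier m) (x : ell 𝕜 q) (k : ℕ) :
    mulCLM q m x k = m k * x k := by
  rw [mulCLM, dif_pos hm]
  rfl

lemma norm_mulCLM_le {m : ℕ → 𝕜} {M : ℝ} (hm : ∀ k, ‖m k‖ ≤ M) : ‖mulCLM q m‖ ≤ M :=
  ContinuousLinearMap.opNorm_le_bound _ ((norm_nonneg _).trans (hm 0)) fun x =>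
    norm_mul_le_of_forall_le hm x _ fun k => mulCLM_apply ⟨M, hm⟩ x k

lemma mulCLM_ext {T : ell 𝕜 q →L[𝕜] ell 𝕜 q} {m : ℕ → 𝕜} (hm : IsMultiplier m)
    (h : ∀ x k, T x k = m k * x k) : T = mulCLM q m := by
  ext x k
  rw [h, mulCLM_apply hm]

lemma IsMultiplier.sub {m n : ℕ → 𝕜} (hm : IsMultiplier m) (hn : IsMultiplier n) :
    IsMultiplier fun k => m k - n k := by
  obtain ⟨M, hM⟩ := hm
  obtain ⟨N, hN⟩ := hn
  exact ⟨M + N, fun k => (norm_sub_le _ _).trans (add_le_add (hM k) (hN k))⟩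

lemma IsMultiplier.const_mul {m : ℕ → 𝕜} (hm : IsMultiplier m) (c : 𝕜) :
    IsMultiplier fun k => c * m k := by
  obtain ⟨M, hM⟩ := hm
  refine ⟨‖c‖ * M, fun k => ?_⟩
  rw [norm_mul]
  gcongr
  exact hM k

lemma mulCLM_sub {m n : ℕ → 𝕜} (hm : IsMultiplier m) (hn : IsMultiplier n) :
    mulCLM q m - mulCLM q n = mulCLM q fun k => m k - n k := by
  refine mulCLM_ext (hm.sub hn) fun x k => ?_
  rw [sub_apply, lp.coeFn_sub, Pi.sub_apply, mulCLM_apply hm, mulCLM_apply hn,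
    sub_mul]

lemma smul_mulCLM {m : ℕ → 𝕜} (hm : IsMultiplier m) (c : 𝕜) :
    c • mulCLM q m = mulCLM q fun k => c * m k := by
  refine mulCLM_ext (hm.const_mul c) fun x k => ?_
  rw [smul_apply, lp.coeFn_smul, Pi.smul_apply, mulCLM_apply hm, smul_eq_mul,
    mul_assoc]

/-- Dominated convergence in `ℓ^q`. -/
lemma tendsto_zero_of_dominated {ι : Type*} {l : Filter ι} (hq : q < ∞) {f : ι → ell 𝕜 q}
    (x : ell 𝕜 q) {M : ℝ} (hM : 0 ≤ M) (hf : ∀ᶠ i in l, ∀ k, ‖f i k‖ ≤ M * ‖x k‖)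
    (h : ∀ k, Tendsto (fun i => f i k) l (𝓝 0)) : Tendsto f l (𝓝 0) := by
  have hp := exponent_toReal_pos hq
  have h1 : Tendsto (fun i => ∑' k, ‖f i k‖ ^ q.toReal) l (𝓝 (∑' _ : ℕ, (0 : ℝ))) := by
    refine tendsto_tsum_of_dominated_convergence
      (bound := fun k => M ^ q.toReal * ‖x k‖ ^ q.toReal)
      (((lp.memℓp x).summable hp).mul_left _) (fun k => ?_) (hf.mono fun i hi k => ?_)
    · have := ((h k).norm).rpow_const (p := q.toReal) (Or.inr hp.le)
      simpa [Real.zero_rpow hp.ne'] using this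
    · rw [Real.norm_of_nonneg (by positivity), ← Real.mul_rpow hM (norm_nonneg _)]
      gcongr
      exact hi k
  rw [tsum_zero] at h1
  have h2 := h1.rpow_const (p := 1 / q.toReal) (Or.inr (by positivity))
  rw [Real.zero_rpow (by positivity)] at h2
  refine tendsto_zero_iff_norm_tendsto_zero.2 (h2.congr fun i => ?_)
  rw [lp.norm_eq_tsum_rpow hp]

/-- Convergence is strong only: uniformly bounded multipliers that converge coordinatewise, tested
on a fixed vector. This is where `q < ∞` enters strong continuity and density. -/
lemma tendsto_mulCLM {ι : Type*} {l : Filter ι} (hq : q < ∞) {m : ι → ℕ → 𝕜} {m₀ : ℕ → 𝕜} {M : ℝ}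
    (hm : ∀ᶠ i in l, ∀ k, ‖m i k‖ ≤ M) (hm₀ : ∀ k, ‖m₀ k‖ ≤ M)
    (h : ∀ k, Tendsto (fun i => m i k) l (𝓝 (m₀ k))) (x : ell 𝕜 q) :
    Tendsto (fun i => mulCLM q (m i) x) l (𝓝 (mulCLM q m₀ x)) := by
  have h0 : 0 ≤ M := (norm_nonneg _).trans (hm₀ 0)
  rw [← tendsto_sub_nhds_zero_iff]
  refine (tendsto_zero_of_dominated hq x (M := M + M) (by positivity)
    (f := fun i => mulCLM q (m i) x - mulCLM q m₀ x) (hm.mono fun i hi k => ?_) fun k => ?_)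
  · rw [lp.coeFn_sub, Pi.sub_apply, mulCLM_apply ⟨M, hi⟩, mulCLM_apply ⟨M, hm₀⟩, ← sub_mul, norm_mul]
    gcongr
    exact (norm_sub_le _ _).trans (add_le_add (hi k) (hm₀ k))
  · have h3 : Tendsto (fun i => (m i k - m₀ k) * x k) l (𝓝 0) := by
      simpa using ((h k).sub_const (m₀ k)).mul_const (x k)
    refine h3.congr' (hm.mono fun i hi => ?_)
    beta_reduce
    rw [lp.coeFn_sub, Pi.sub_apply, mulCLM_apply ⟨M, hi⟩, mulCLM_apply ⟨M, hm₀⟩, ← sub_mul]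

end Multipliers

/-! ### Resolvent and semigroup of the diagonal operator -/

section Diagonal

variable {𝕜 : Type*} [RCLike 𝕜] {q : ℝ≥0∞} [Fact (1 ≤ q)] {lam : ℕ → ℝ}

lemma mem_domain_diagOp {x : ell 𝕜 q} :
    x ∈ (diagOp 𝕜 q lam).domain ↔ Memℓp (fun k => ((lam k : ℝ) : 𝕜) * x k) q := Iff.rfl

lemma diagOp_apply (x : (diagOp 𝕜 q lam).domain) (k : ℕ) :
    diagOp 𝕜 q lam x k = ((lam k : ℝ) : 𝕜) * (x : ell 𝕜 q) k := rfl

lemma isMultiplier_inv_sub {z : 𝕜} {d : ℝ} (hd : 0 < d) (h : ∀ k, d ≤ ‖z - (lam k : 𝕜)‖) :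
    ∀ k, ‖(z - (lam k : 𝕜))⁻¹‖ ≤ d⁻¹ := fun k => by
  rw [norm_inv]
  exact inv_anti₀ hd (h k)

lemma isResolventAt_diagOp {z : 𝕜} {d : ℝ} (hd : 0 < d) (h : ∀ k, d ≤ ‖z - (lam k : 𝕜)‖) :
    IsResolventAt (diagOp 𝕜 q lam) z (mulCLM q fun k => (z - (lam k : 𝕜))⁻¹) := by
  have hm : IsMultiplier fun k => (z - (lam k : 𝕜))⁻¹ := ⟨_, isMultiplier_inv_sub hd h⟩
  have hne : ∀ k, z - (lam k : 𝕜) ≠ 0 := fun k => norm_pos_iff.1 (hd.trans_le (h k))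
  refine ⟨fun x => ?_, fun x => ?_⟩
  · have hdom : mulCLM q (fun k => (z - (lam k : 𝕜))⁻¹) x ∈ (diagOp 𝕜 q lam).domain := by
      rw [mem_domain_diagOp]
      -- With `R` the candidate resolvent, `λ_k (R x)_k = z (R x)_k - x_k`, and the right side is
      -- visibly in `ℓ^q`.
      have h2 : Memℓp (z • ⇑(mulCLM q (fun k => (z - (lam k : 𝕜))⁻¹) x) - ⇑x) q :=
        ((lp.memℓp _).const_smul z).sub (lp.memℓp x)
      convert h2 using 1
      funext k
      rw [Pi.sub_apply, Pi.smul_apply, mulCLM_apply hm, smul_eq_mul]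
      have := hne k
      field_simp
      ring
    refine ⟨hdom, ?_⟩
    ext k
    rw [lp.coeFn_sub, Pi.sub_apply, diagOp_apply, lp.coeFn_smul, Pi.smul_apply, smul_eq_mul,
      mulCLM_apply hm]
    have := hne k
    field_simp
  · ext k
    rw [mulCLM_apply hm, lp.coeFn_sub, Pi.sub_apply, diagOp_apply, lp.coeFn_smul, Pi.smul_apply,
      smul_eq_mul, ← sub_mul, inv_mul_cancel_left₀ (hne k)]

lemma IsResolventAt.unique {E : Type*} [NormedAddCommGroup E] [NormedSpace 𝕜 E] {A : E →ₗ.[𝕜] E}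
    {z : 𝕜} {R R' : E →L[𝕜] E} (h : IsResolventAt A z R) (h' : IsResolventAt A z R') : R = R' := by
  ext x
  obtain ⟨hd, hx⟩ := h'.1 x
  have := h.2 ⟨R' x, hd⟩
  rwa [hx] at this

lemma IsResolventAt.resolventOp_eq {E : Type*} [NormedAddCommGroup E] [NormedSpace 𝕜 E]
    {A : E →ₗ.[𝕜] E} {z : 𝕜} {R : E →L[𝕜] E} (h : IsResolventAt A z R) : resolventOp A z = R := by
  rw [resolventOp, dif_pos ⟨R, h⟩]
  exact IsResolventAt.unique (Exists.choose_spec (⟨R, h⟩ : ∃ R, IsResolventAt A z R)) h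

lemma resolventOp_diagOp {z : 𝕜} {d : ℝ} (hd : 0 < d) (h : ∀ k, d ≤ ‖z - (lam k : 𝕜)‖) :
    resolventOp (diagOp 𝕜 q lam) z = mulCLM q fun k => (z - (lam k : 𝕜))⁻¹ :=
  (isResolventAt_diagOp hd h).resolventOp_eq

/-- The diagonal semigroup `S(t) e_k = exp (-t λ_k) e_k`. -/
def diagSemigroup (𝕜 : Type*) [RCLike 𝕜] (q : ℝ≥0∞) [Fact (1 ≤ q)] (lam : ℕ → ℝ) (t : ℝ) :
    ell 𝕜 q →L[𝕜] ell 𝕜 q :=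
  mulCLM q fun k => ((Real.exp (-(t * lam k)) : ℝ) : 𝕜)

lemma norm_exp_neg_mul_le (hpos : ∀ k, 0 < lam k) {t : ℝ} (ht : 0 ≤ t) (k : ℕ) :
    ‖((Real.exp (-(t * lam k)) : ℝ) : 𝕜)‖ ≤ 1 := by
  rw [RCLike.norm_ofReal, abs_of_pos (Real.exp_pos _), Real.exp_le_one_iff]
  have := mul_nonneg ht (hpos k).le
  linarith

lemma diagSemigroup_apply (hpos : ∀ k, 0 < lam k) {t : ℝ} (ht : 0 ≤ t) (x : ell 𝕜 q) (k : ℕ) :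
    diagSemigroup 𝕜 q lam t x k = ((Real.exp (-(t * lam k)) : ℝ) : 𝕜) * x k :=
  mulCLM_apply ⟨1, norm_exp_neg_mul_le hpos ht⟩ x k

lemma isC0Semigroup_diagSemigroup (hq : q < ∞) (hpos : ∀ k, 0 < lam k) :
    IsC0Semigroup (diagSemigroup 𝕜 q lam) where
  zero := by
    ext x k
    rw [diagSemigroup_apply hpos le_rfl]
    simp
  add s t hs ht := by
    ext x k
    rw [ContinuousLinearMap.comp_apply, diagSemigroup_apply hpos (add_nonneg hs ht),
      diagSemigroup_apply hpos hs, diagSemigroup_apply hpos ht, ← mul_assoc, ← RCLike.ofReal_mul,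
      ← Real.exp_add]
    ring_nf
  strongCont x t ht := by
    refine tendsto_mulCLM hq (M := 1) (eventually_mem_nhdsWithin.mono fun s hs =>
      norm_exp_neg_mul_le hpos hs) (norm_exp_neg_mul_le hpos ht) (fun k => ?_) x
    have : Continuous fun s : ℝ => ((Real.exp (-(s * lam k)) : ℝ) : 𝕜) :=
      RCLike.continuous_ofReal.comp (by fun_prop)
    exact this.continuousWithinAt

lemma abs_exp_neg_sub_one_div_le {s : ℝ} (hs : 0 < s) : |s⁻¹ * (Real.exp (-s) - 1)| ≤ 1 := by
  have h1 : Real.exp (-s) ≤ 1 := Real.exp_le_one_iff.2 (by linarith)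
  have h2 := Real.add_one_le_exp (-s)
  rw [abs_mul, abs_inv, abs_of_pos hs, abs_of_nonpos (by linarith), inv_mul_le_iff₀ hs]
  linarith

lemma tendsto_exp_neg_mul_sub_one_div (c : ℝ) :
    Tendsto (fun h : ℝ => h⁻¹ * (Real.exp (-(h * c)) - 1)) (𝓝[>] 0) (𝓝 (-c)) := by
  have h : HasDerivAt (fun h : ℝ => Real.exp (-(h * c))) (-c) 0 := by
    have := ((hasDerivAt_id (0 : ℝ)).mul_const c).neg.exp
    simpa using this
  have h1 := hasDerivAt_iff_tendsto_slope_zero.1 h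
  refine (h1.mono_left (nhdsWithin_mono _ fun x hx => ne_of_gt hx)).congr fun t => ?_
  simp

/-- Each coordinate of the difference quotient tends to `-λ_k x_k`, whatever `x` is. If `x ∈ D(A)`,
then `|(e^{-s} - 1)/s| ≤ 1` at `s = h λ_k` dominates the quotient by `A x`, and convergence holds in
norm. Conversely a norm limit has the coordinates `-λ_k x_k`, which places `x` in the maximal
domain. -/
lemma generates_diagSemigroup (hq : q < ∞) (hpos : ∀ k, 0 < lam k) :
    Generates (-(diagOp 𝕜 q lam)) (diagSemigroup 𝕜 q lam) := by
  refine ⟨isC0Semigroup_diagSemigroup hq hpos, fun x y => ?_⟩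
  have hcoord : ∀ k, Tendsto (fun h : ℝ => (((h : 𝕜)⁻¹) • (diagSemigroup 𝕜 q lam h x - x)) k)
      (𝓝[>] 0) (𝓝 (-((lam k : 𝕜) * x k))) := fun k => by
    have h1 := ((RCLike.continuous_ofReal (K := 𝕜)).tendsto _).comp
      (tendsto_exp_neg_mul_sub_one_div (lam k))
    have h2 := h1.mul_const (x k)
    rw [RCLike.ofReal_neg, neg_mul] at h2
    refine h2.congr' (eventually_mem_nhdsWithin.mono fun h hh => ?_)
    have hh : 0 < h := hh
    beta_reduce
    rw [lp.coeFn_smul, Pi.smul_apply, lp.coeFn_sub, Pi.sub_apply, diagSemigroup_apply hpos hh.le,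
      smul_eq_mul, Function.comp_apply]
    push_cast
    ring
  rw [LinearPMap.mem_graph_iff]
  constructor
  · rintro ⟨u, hux, hy⟩
    have hux : (u : ell 𝕜 q) = x := hux
    have hy : (-(diagOp 𝕜 q lam)) u = y := hy
    have hx : x ∈ (diagOp 𝕜 q lam).domain := hux ▸ u.2
    set v : ell 𝕜 q := diagOp 𝕜 q lam ⟨x, hx⟩ with hv
    have hvk : ∀ k, v k = (lam k : 𝕜) * x k := fun k => rfl
    have hyv : y = -v := by
      rw [← hy, LinearPMap.neg_apply, hv]
      congr 2
      exact Subtype.ext hux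
    rw [← tendsto_sub_nhds_zero_iff]
    have hyk : ∀ k, y k = -((lam k : 𝕜) * x k) := fun k => by
      rw [hyv, lp.coeFn_neg, Pi.neg_apply, hvk]
    refine tendsto_zero_of_dominated hq v (M := 2) zero_le_two
      (eventually_mem_nhdsWithin.mono fun h hh k => ?_) fun k => ?_
    · have hh : 0 < h := hh
      have hs : 0 < h * lam k := mul_pos hh (hpos k)
      have h1 : (((h : 𝕜)⁻¹) • (diagSemigroup 𝕜 q lam h x - x) - y) k =
          (((h * lam k)⁻¹ * (Real.exp (-(h * lam k)) - 1) : ℝ) + 1 : 𝕜) * v k := by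
        rw [lp.coeFn_sub, Pi.sub_apply, hyk, hvk, lp.coeFn_smul, Pi.smul_apply, lp.coeFn_sub,
          Pi.sub_apply, diagSemigroup_apply hpos hh.le, smul_eq_mul]
        have h2 : (h : 𝕜) ≠ 0 := by exact_mod_cast hh.ne'
        have h3 : (lam k : 𝕜) ≠ 0 := by exact_mod_cast (hpos k).ne'
        push_cast
        field_simp
        ring
      rw [h1, norm_mul]
      gcongr
      refine (norm_add_le _ _).trans ?_
      rw [RCLike.norm_ofReal, norm_one]
      linarith [abs_exp_neg_sub_one_div_le hs]
    · have := (hcoord k).sub_const (y k)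
      rw [hyk, sub_self] at this
      refine this.congr fun h => ?_
      rw [lp.coeFn_sub, Pi.sub_apply, hyk]
  · intro hlim
    have hyk : ∀ k, y k = -((lam k : 𝕜) * x k) := fun k =>
      tendsto_nhds_unique (((lp.evalCLM 𝕜 (fun _ : ℕ => 𝕜) q k).continuous.tendsto y).comp hlim)
        (hcoord k)
    have hx : x ∈ (diagOp 𝕜 q lam).domain := by
      rw [mem_domain_diagOp]
      convert (lp.memℓp y).neg using 1
      funext k
      rw [Pi.neg_apply, hyk, neg_neg]
    refine ⟨⟨x, hx⟩, rfl, ?_⟩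
    rw [LinearPMap.neg_apply]
    ext k
    rw [lp.coeFn_neg, Pi.neg_apply, hyk]
    rfl

end Diagonal

/-! ### Geometry of sectors -/

section Sector

lemma isOpen_sector {σ : ℝ} (hσ : σ < Real.pi) : IsOpen (sector σ) := by
  have h : sector σ = Complex.slitPlane ∩ (fun z => |z.arg|) ⁻¹' Iio σ := by
    ext z
    simp only [sector, mem_ofPred_eq, mem_inter_iff, mem_preimage, mem_Iio,
      Complex.mem_slitPlane_iff_arg]
    constructor
    · rintro ⟨h0, h1⟩
      refine ⟨⟨fun h2 => ?_, h0⟩, h1⟩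
      rw [h2, abs_of_pos Real.pi_pos] at h1
      linarith
    · rintro ⟨⟨_, h0⟩, h1⟩
      exact ⟨h0, h1⟩
  rw [h]
  refine ContinuousOn.isOpen_inter_preimage (fun z hz => ?_) Complex.isOpen_slitPlane isOpen_Iio
  exact ((Complex.continuousAt_arg hz).abs).continuousWithinAt

lemma ofReal_mem_sector {σ l : ℝ} (hσ : 0 < σ) (hl : 0 < l) : (l : ℂ) ∈ sector σ := by
  refine ⟨by exact_mod_cast hl.ne', ?_⟩
  rwa [Complex.arg_ofReal_of_nonneg hl.le, abs_zero]

lemma arg_ray {r θ : ℝ} (hr : 0 < r) (hθ : |θ| < Real.pi) :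
    ((r : ℂ) * Complex.exp (θ * Complex.I)).arg = θ := by
  rw [Complex.exp_mul_I]
  exact Complex.arg_mul_cos_add_sin_mul_I hr ⟨(abs_lt.1 hθ).1, (abs_lt.1 hθ).2.le⟩

lemma norm_ray {r : ℝ} (hr : 0 ≤ r) (θ : ℝ) : ‖(r : ℂ) * Complex.exp (θ * Complex.I)‖ = r := by
  rw [norm_mul, Complex.norm_exp_ofReal_mul_I, mul_one, Complex.norm_real, Real.norm_of_nonneg hr]

lemma ray_re (r θ : ℝ) : ((r : ℂ) * Complex.exp (θ * Complex.I)).re = r * Real.cos θ := by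
  rw [Complex.re_ofReal_mul, Complex.exp_ofReal_mul_I_re]

lemma ray_im (r θ : ℝ) : ((r : ℂ) * Complex.exp (θ * Complex.I)).im = r * Real.sin θ := by
  rw [Complex.im_ofReal_mul, Complex.exp_ofReal_mul_I_im]

lemma ray_mem_sector {r θ σ : ℝ} (hr : 0 < r) (hθ : |θ| < Real.pi) (h : |θ| < σ) :
    (r : ℂ) * Complex.exp (θ * Complex.I) ∈ sector σ := by
  refine ⟨mul_ne_zero (by exact_mod_cast hr.ne') (Complex.exp_ne_zero _), ?_⟩
  rwa [arg_ray hr hθ]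

lemma ray_notMem_sector {r θ : ℝ} (hr : 0 < r) (hθ : |θ| < Real.pi) :
    (r : ℂ) * Complex.exp (θ * Complex.I) ∉ sector |θ| := fun h => by
  have := h.2
  rw [arg_ray hr hθ] at this
  exact lt_irrefl _ this

/-- The distance from `z` to the positive half-line is at least `|z|` when `Re z ≤ 0`, and at least
`|Im z| = |z| sin |arg z|` when `Re z > 0`. The constant does not depend on `l`, which turns it into
a resolvent bound. -/
lemma sin_mul_norm_le_norm_sub {σ l : ℝ} (hσ : 0 < σ) (hσ' : σ < Real.pi) (hl : 0 < l) {z : ℂ}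
    (hz : z ∉ sector σ) : Real.sin σ * ‖z‖ ≤ ‖z - l‖ := by
  rcases eq_or_ne z 0 with rfl | h0
  · simp
  have harg : σ ≤ |z.arg| := by
    by_contra! h
    exact hz ⟨h0, h⟩
  have hs : 0 < Real.sin σ := Real.sin_pos_of_pos_of_lt_pi hσ hσ'
  rcases le_or_gt z.re 0 with hre | hre
  · have h1 : ‖z‖ ≤ ‖z - l‖ := by
      rw [Complex.norm_def, Complex.norm_def]
      refine Real.sqrt_le_sqrt ?_
      rw [Complex.normSq_apply, Complex.normSq_apply]
      simp only [Complex.sub_re, Complex.sub_im, Complex.ofReal_re, Complex.ofReal_im, sub_zero]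
      nlinarith
    exact (mul_le_of_le_one_left (norm_nonneg z) (Real.sin_le_one σ)).trans h1
  · have h1 : |z.arg| < Real.pi / 2 := Complex.abs_arg_lt_pi_div_two_iff.2 (Or.inl hre)
    have h2 : Real.sin σ ≤ Real.sin |z.arg| :=
      Real.sin_le_sin_of_le_of_le_pi_div_two (by linarith [Real.pi_pos]) h1.le harg
    have h3 : Real.sin |z.arg| = |z.im| / ‖z‖ := by
      rw [← abs_norm z, ← abs_div, ← Complex.sin_arg]
      rcases abs_cases z.arg with ⟨h, h'⟩ | ⟨h, h'⟩
      · rw [h, abs_of_nonneg (Real.sin_nonneg_of_nonneg_of_le_pi h' (Complex.arg_le_pi z))]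
      · rw [h, Real.sin_neg,
          abs_of_neg (Real.sin_neg_of_neg_of_neg_pi_lt h' (Complex.neg_pi_lt_arg z))]
    have h4 : |z.im| ≤ ‖z - l‖ := by
      have := Complex.abs_im_le_norm (z - l)
      simpa using this
    have hz0 : 0 < ‖z‖ := norm_pos_iff.2 h0
    rw [h3, le_div_iff₀ hz0] at h2
    exact h2.trans h4

end Sector

/-! ### Decay and integrability of functions of class `H^∞_0` -/

section HInftyZero

/-- The bound `r ^ ε / (1 + r ^ 2) ^ ε` is a power of `r / (1 + r ^ 2)`. -/
lemma rpow_div_rpow_eq {r : ℝ} (hr : 0 ≤ r) (ε : ℝ) :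
    r ^ ε / (1 + r ^ 2) ^ ε = (r / (1 + r ^ 2)) ^ ε :=
  (Real.div_rpow hr (by positivity) ε).symm

lemma IsHInftyZero.exists_bound {σ : ℝ} {φ : ℂ → ℂ} (h : IsHInftyZero σ φ) :
    ∃ C ε : ℝ, 0 ≤ C ∧ 0 < ε ∧ ∀ z ∈ sector σ, ‖φ z‖ ≤ C * (‖z‖ / (1 + ‖z‖ ^ 2)) ^ ε := by
  obtain ⟨-, C, ε, hε, hC⟩ := h
  refine ⟨|C|, ε, abs_nonneg C, hε, fun z hz => (hC z hz).trans ?_⟩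
  rw [mul_div_assoc, rpow_div_rpow_eq (norm_nonneg z)]
  gcongr
  exact le_abs_self C

lemma IsHInftyZero.bddAbove {σ : ℝ} {φ : ℂ → ℂ} (h : IsHInftyZero σ φ) :
    BddAbove (range fun z : sector σ => ‖φ z‖) := by
  obtain ⟨C, ε, hC0, hε, hC⟩ := h.exists_bound
  refine ⟨C, ?_⟩
  rintro _ ⟨z, rfl⟩
  refine (hC z z.2).trans (mul_le_of_le_one_right hC0 (Real.rpow_le_one (by positivity) ?_ hε.le))
  rw [div_le_one (by positivity)]
  nlinarith [sq_nonneg (‖(z : ℂ)‖ - 1)]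

lemma tendsto_div_one_add_sq_atTop : Tendsto (fun r : ℝ => r / (1 + r ^ 2)) atTop (𝓝 0) := by
  refine tendsto_of_tendsto_of_tendsto_of_le_of_le' tendsto_const_nhds tendsto_inv_atTop_zero
    ((eventually_gt_atTop 0).mono fun r hr => by positivity)
    ((eventually_gt_atTop 0).mono fun r hr => ?_)
  rw [div_le_iff₀ (by positivity), ← div_eq_inv_mul, le_div_iff₀ hr]
  nlinarith

lemma continuous_div_one_add_sq : Continuous fun r : ℝ => r / (1 + r ^ 2) :=
  continuous_id.div (by fun_prop) fun r => by positivity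

lemma tendsto_div_one_add_sq_zero : Tendsto (fun r : ℝ => r / (1 + r ^ 2)) (𝓝 0) (𝓝 0) := by
  simpa using continuous_div_one_add_sq.tendsto 0

lemma tendsto_const_mul_rpow_zero {l : Filter ℝ} (h : Tendsto (fun r : ℝ => r / (1 + r ^ 2)) l (𝓝 0))
    (C : ℝ) {ε : ℝ} (hε : 0 < ε) :
    Tendsto (fun r : ℝ => C * (r / (1 + r ^ 2)) ^ ε) l (𝓝 0) := by
  have := (h.rpow_const (p := ε) (Or.inr hε.le)).const_mul C
  rwa [Real.zero_rpow hε.ne', mul_zero] at this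

/-- This majorizes `φ(z) (z - A)⁻¹` on a ray: the first factor is the decay of `φ`, the second that
of the resolvent. It is at most `r^{ε-1}` near `0` and `r^{-ε-1}` near infinity. -/
lemma integrableOn_rpow_div_one_add_sq {ε : ℝ} (hε : 0 < ε) :
    IntegrableOn (fun r : ℝ => (r / (1 + r ^ 2)) ^ ε * r⁻¹) (Ioi 0) := by
  have hcont : ContinuousOn (fun r : ℝ => (r / (1 + r ^ 2)) ^ ε * r⁻¹) (Ioi 0) := by
    exact ContinuousOn.mul (continuous_div_one_add_sq.continuousOn.rpow_const
      fun r _ => Or.inr hε.le) (continuousOn_inv₀.mono fun r (hr : 0 < r) => hr.ne')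
  rw [← Ioc_union_Ioi_eq_Ioi zero_le_one]
  refine IntegrableOn.union ?_ ?_
  · have h1 : IntegrableOn (fun r : ℝ => r ^ (ε - 1)) (Ioc 0 1) :=
      (intervalIntegrable_iff_integrableOn_Ioc_of_le zero_le_one).1
        (intervalIntegral.intervalIntegrable_rpow' (by linarith))
    refine Integrable.mono' h1 ((hcont.mono fun r hr => hr.1).aestronglyMeasurable measurableSet_Ioc)
      ((ae_restrict_mem measurableSet_Ioc).mono fun r hr => ?_)
    have hr0 : 0 < r := hr.1
    have h2 : r / (1 + r ^ 2) ≤ r := div_le_self hr0.le (by nlinarith)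
    rw [Real.norm_of_nonneg (by positivity), Real.rpow_sub_one hr0.ne', div_eq_mul_inv (r ^ ε)]
    exact mul_le_mul_of_nonneg_right (Real.rpow_le_rpow (by positivity) h2 hε.le) (by positivity)
  · have h1 : IntegrableOn (fun r : ℝ => r ^ (-ε - 1)) (Ioi 1) :=
      integrableOn_Ioi_rpow_of_lt (by linarith) zero_lt_one
    refine Integrable.mono' h1 ((hcont.mono fun r hr => zero_lt_one.trans (mem_Ioi.1 hr)).aestronglyMeasurable
      measurableSet_Ioi) ((ae_restrict_mem measurableSet_Ioi).mono fun r hr => ?_)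
    have hr0 : 0 < r := zero_lt_one.trans (mem_Ioi.1 hr)
    rw [Real.norm_of_nonneg (by positivity), Real.rpow_sub_one hr0.ne', div_eq_mul_inv (r ^ (-ε)),
      Real.rpow_neg hr0.le, ← Real.inv_rpow hr0.le]
    gcongr
    rw [div_le_iff₀ (by positivity), ← div_eq_inv_mul, le_div_iff₀ hr0]
    nlinarith

lemma continuous_ray (θ : ℝ) : Continuous fun r : ℝ => (r : ℂ) * Complex.exp (θ * Complex.I) := by
  fun_prop

lemma IsHInftyZero.integrableOn_ray {E : Type*} [NormedAddCommGroup E] [NormedSpace ℂ E] {σ θ : ℝ}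
    {φ : ℂ → ℂ} (h : IsHInftyZero σ φ) (hθ : |θ| < σ) (hσ : σ < Real.pi) {F : ℝ → E}
    (hF : ContinuousOn F (Ioi 0)) {M : ℝ} (hM : ∀ r, 0 < r → ‖F r‖ ≤ M * r⁻¹) :
    IntegrableOn (fun r : ℝ => (φ (r * Complex.exp (θ * Complex.I)) *
      Complex.exp (θ * Complex.I)) • F r) (Ioi 0) := by
  obtain ⟨C, ε, hC0, hε, hC⟩ := h.exists_bound
  have hmem : ∀ r : ℝ, 0 < r → (r : ℂ) * Complex.exp (θ * Complex.I) ∈ sector σ := fun r hr =>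
    ray_mem_sector hr (hθ.trans hσ) hθ
  have hcont : ContinuousOn (fun r : ℝ => (φ (r * Complex.exp (θ * Complex.I)) *
      Complex.exp (θ * Complex.I)) • F r) (Ioi 0) :=
    ((h.1.continuousOn.comp (continuous_ray θ).continuousOn hmem).mul continuousOn_const).smul hF
  refine Integrable.mono' ((integrableOn_rpow_div_one_add_sq hε).const_mul (C * M))
    (hcont.aestronglyMeasurable measurableSet_Ioi)
    ((ae_restrict_mem measurableSet_Ioi).mono fun r hr => ?_)
  have hr0 : 0 < r := hr
  rw [norm_smul, norm_mul, Complex.norm_exp_ofReal_mul_I, mul_one]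
  have h1 := hC _ (hmem r hr0)
  rw [norm_ray hr0.le] at h1
  calc _ ≤ (C * (r / (1 + r ^ 2)) ^ ε) * (M * r⁻¹) :=
        mul_le_mul h1 (hM r hr0) (norm_nonneg _) (by positivity)
    _ = _ := by ring

end HInftyZero

/-! ### Cauchy's theorem on a sector for functions vanishing at the pole -/

section Cauchy

variable {σ θ l : ℝ} {φ : ℂ → ℂ}

lemma mul_le_norm_ray_sub (hθ0 : θ ≠ 0) (hθ : |θ| < Real.pi) (hl : 0 < l) {r : ℝ} (hr : 0 < r) :
    Real.sin |θ| * r ≤ ‖(r : ℂ) * Complex.exp (θ * Complex.I) - l‖ := by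
  have := sin_mul_norm_le_norm_sub (abs_pos.2 hθ0) hθ hl (ray_notMem_sector hr hθ)
  rwa [norm_ray hr.le] at this

lemma sin_abs_pos (hθ0 : θ ≠ 0) (hθ : |θ| < Real.pi) : 0 < Real.sin |θ| :=
  Real.sin_pos_of_pos_of_lt_pi (abs_pos.2 hθ0) hθ

lemma ray_sub_ne_zero (hθ0 : θ ≠ 0) (hθ : |θ| < Real.pi) (hl : 0 < l) {r : ℝ} (hr : 0 < r) :
    (r : ℂ) * Complex.exp (θ * Complex.I) - l ≠ 0 :=
  norm_pos_iff.1 ((mul_pos (sin_abs_pos hθ0 hθ) hr).trans_le (mul_le_norm_ray_sub hθ0 hθ hl hr))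

lemma norm_inv_ray_sub_le (hθ0 : θ ≠ 0) (hθ : |θ| < Real.pi) (hl : 0 < l) {r : ℝ} (hr : 0 < r) :
    ‖((r : ℂ) * Complex.exp (θ * Complex.I) - l)⁻¹‖ ≤ (Real.sin |θ|)⁻¹ * r⁻¹ := by
  rw [norm_inv, ← mul_inv]
  exact inv_anti₀ (mul_pos (sin_abs_pos hθ0 hθ) hr) (mul_le_norm_ray_sub hθ0 hθ hl hr)

lemma continuousOn_inv_ray_sub (hθ0 : θ ≠ 0) (hθ : |θ| < Real.pi) (hl : 0 < l) :
    ContinuousOn (fun r : ℝ => ((r : ℂ) * Complex.exp (θ * Complex.I) - l)⁻¹) (Ioi 0) :=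
  ContinuousOn.inv₀ (by fun_prop) fun _ hr => ray_sub_ne_zero hθ0 hθ hl hr

/-- The integral of `φ(z) (z - l)⁻¹` along the ray of argument `θ`. -/
def cauchyRay (φ : ℂ → ℂ) (l θ : ℝ) : ℂ :=
  ∫ r in Ioi (0 : ℝ), (φ (r * Complex.exp (θ * Complex.I)) * Complex.exp (θ * Complex.I)) •
    ((r : ℂ) * Complex.exp (θ * Complex.I) - l)⁻¹

lemma IsHInftyZero.integrableOn_cauchyRay (h : IsHInftyZero σ φ) (hθ0 : θ ≠ 0) (hθ : |θ| < σ)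
    (hσ : σ < Real.pi) (hl : 0 < l) :
    IntegrableOn (fun r : ℝ => (φ (r * Complex.exp (θ * Complex.I)) *
      Complex.exp (θ * Complex.I)) • ((r : ℂ) * Complex.exp (θ * Complex.I) - l)⁻¹) (Ioi 0) :=
  h.integrableOn_ray hθ hσ (continuousOn_inv_ray_sub hθ0 (hθ.trans hσ) hl)
    fun _ hr => norm_inv_ray_sub_le hθ0 (hθ.trans hσ) hl hr

/-- The exhaustion of `(0, ∞)` is chosen to match the rectangles `[-R, R] × [-θ, θ]` in the
logarithmic coordinate. -/
lemma tendsto_integral_exp {E : Type*} [NormedAddCommGroup E] [NormedSpace ℝ E] {f : ℝ → E}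
    (hf : IntegrableOn f (Ioi 0)) :
    Tendsto (fun R : ℝ => ∫ r in Real.exp (-R)..Real.exp R, f r) atTop
      (𝓝 (∫ r in Ioi (0 : ℝ), f r)) := by
  have hcov : AECover (volume.restrict (Ioi (0 : ℝ))) atTop
      fun R : ℝ => Ioc (Real.exp (-R)) (Real.exp R) := by
    refine ⟨(ae_restrict_mem measurableSet_Ioi).mono fun r hr => ?_, fun _ => measurableSet_Ioc⟩
    have hr : 0 < r := hr
    have h1 : Tendsto (fun R : ℝ => Real.exp (-R)) atTop (𝓝 0) :=
      Real.tendsto_exp_atBot.comp tendsto_neg_atTop_atBot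
    filter_upwards [h1.eventually_lt_const hr, Real.tendsto_exp_atTop.eventually_ge_atTop r]
      with R h2 h3 using ⟨h2, h3⟩
  refine (hcov.integral_tendsto_of_countably_generated hf).congr' ?_
  filter_upwards [eventually_ge_atTop 0] with R hR
  rw [intervalIntegral.integral_of_le (Real.exp_le_exp.2 (by linarith)),
    Measure.restrict_restrict measurableSet_Ioc, inter_eq_left.2]
  exact fun r hr => (Real.exp_pos _).trans hr.1

lemma exp_add_mul_I (x θ : ℝ) : Complex.exp (x + θ * Complex.I) =
    (Real.exp x : ℝ) * Complex.exp (θ * Complex.I) := by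
  rw [Complex.exp_add, Complex.ofReal_exp]

lemma integral_horizontal_eq (F : ℂ → ℂ) (θ R : ℝ)
    (hF : ContinuousOn (fun r : ℝ => F (r * Complex.exp (θ * Complex.I))) (Ioi 0)) :
    ∫ x in (-R)..R, F (Complex.exp (x + θ * Complex.I)) * Complex.exp (x + θ * Complex.I) =
      ∫ r in Real.exp (-R)..Real.exp R,
        F (r * Complex.exp (θ * Complex.I)) * Complex.exp (θ * Complex.I) := by
  have h := intervalIntegral.integral_deriv_smul_comp' (a := -R) (b := R) (f := Real.exp)
    (f' := Real.exp)
    (g := fun r : ℝ => F (r * Complex.exp (θ * Complex.I)) * Complex.exp (θ * Complex.I))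
    (fun x _ => Real.hasDerivAt_exp x) Real.continuous_exp.continuousOn
    ((hF.mul continuousOn_const).mono ?_)
  · rw [← h]
    refine intervalIntegral.integral_congr fun x _ => ?_
    simp only [Function.comp_apply, exp_add_mul_I, Complex.real_smul]
    ring
  · rintro _ ⟨x, -, rfl⟩
    exact Real.exp_pos x

lemma exp_mem_sector {x y : ℝ} (hσ : σ < Real.pi) (hy : |y| < σ) :
    Complex.exp (x + y * Complex.I) ∈ sector σ := by
  rw [exp_add_mul_I]
  exact ray_mem_sector (Real.exp_pos x) (hy.trans hσ) hy

lemma norm_exp_add_mul_I (x y : ℝ) : ‖Complex.exp (x + y * Complex.I)‖ = Real.exp x := by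
  rw [exp_add_mul_I, norm_ray (Real.exp_pos x).le]

/-- Away from the annulus `l/2 < |z| < 2l` one has `|z| ≤ 2 |z - l|`. This controls the vertical
sides of the rectangles, which sit at `|z| = e^{±R}`. -/
lemma norm_dslope_mul_le {u : ℂ → ℂ} (hl : 0 < l) (hu : u l = 0) {z : ℂ}
    (hz : 2 * l ≤ ‖z‖ ∨ ‖z‖ ≤ l / 2) : ‖dslope u l z * z‖ ≤ 2 * ‖u z‖ := by
  have hln : ‖(l : ℂ)‖ = l := by rw [Complex.norm_real, Real.norm_of_nonneg hl.le]
  have h1 : ‖z‖ ≤ 2 * ‖z - l‖ := by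
    have h2 := norm_sub_norm_le z (l : ℂ)
    have h3 := norm_sub_norm_le (l : ℂ) z
    rw [norm_sub_rev (l : ℂ) z] at h3
    rw [hln] at h2 h3
    rcases hz with h | h <;> linarith
  have hne : z ≠ l := by
    rintro rfl
    rw [hln] at hz
    rcases hz with h | h <;> linarith
  have hpos : 0 < ‖z - l‖ := norm_pos_iff.2 (sub_ne_zero.2 hne)
  rw [dslope_of_ne _ hne, slope_def_module, hu, sub_zero, smul_eq_mul, norm_mul, norm_mul, norm_inv,
    mul_assoc, inv_mul_le_iff₀ hpos]
  nlinarith [norm_nonneg (u z)]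

/-- The integrals of `u(z) (z - l)⁻¹` along two rays agree if `u` vanishes at `l`, at `0` and
at `∞`. -/
lemma cauchyRay_neg_eq {u : ℂ → ℂ} {B : ℝ → ℝ} (hu : DifferentiableOn ℂ u (sector σ))
    (hσ : σ < Real.pi) (hl : 0 < l) (hul : u l = 0) (hθ0 : 0 < θ) (hθ : θ < σ)
    (hB : ∀ z ∈ sector σ, ‖u z‖ ≤ B ‖z‖) (hB0 : Tendsto B (𝓝 0) (𝓝 0))
    (hBtop : Tendsto B atTop (𝓝 0))
    (hi : ∀ s : ℝ, |s| = θ → IntegrableOn (fun r : ℝ => (u (r * Complex.exp (s * Complex.I)) *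
      Complex.exp (s * Complex.I)) • ((r : ℂ) * Complex.exp (s * Complex.I) - l)⁻¹) (Ioi 0)) :
    cauchyRay u l (-θ) = cauchyRay u l θ := by
  set F := dslope u (l : ℂ) with hF
  have hFd : DifferentiableOn ℂ F (sector σ) :=
    (Complex.differentiableOn_dslope
      ((isOpen_sector hσ).mem_nhds (ofReal_mem_sector (hθ0.trans hθ) hl))).2 hu
  -- The substitution `z = e^w` turns the sector into a strip, and the extra factor `e^w` is the
  -- Jacobian. Since `u l = 0`, the function `dslope u l` extends `u(z)/(z - l)` analytically across
  -- `l`, so `g` has no pole.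
  set g : ℂ → ℂ := fun w => F (Complex.exp w) * Complex.exp w with hg
  have habs : ∀ s : ℝ, |s| = θ → s ≠ 0 ∧ |s| < Real.pi := fun s hs =>
    ⟨abs_pos.1 (hs ▸ hθ0), by rw [hs]; exact hθ.trans hσ⟩
  have hhor : ∀ s : ℝ, |s| = θ → Tendsto (fun R : ℝ => ∫ x in (-R)..R, g (x + s * Complex.I)) atTop
      (𝓝 (cauchyRay u l s)) := fun s hs => by
    obtain ⟨hs0, hspi⟩ := habs s hs
    refine (tendsto_integral_exp (hi s hs)).congr fun R => ?_
    rw [hg, integral_horizontal_eq]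
    · refine intervalIntegral.integral_congr_ae (ae_of_all _ fun r hr => ?_)
      have hr0 : 0 < r := by
        rw [uIoc, mem_Ioc] at hr
        exact (lt_min (Real.exp_pos _) (Real.exp_pos _)).trans hr.1
      have hne : (r : ℂ) * Complex.exp (s * Complex.I) ≠ l :=
        sub_ne_zero.1 (ray_sub_ne_zero hs0 hspi hl hr0)
      rw [hF, dslope_of_ne _ hne, slope_def_module, hul, sub_zero, smul_eq_mul, smul_eq_mul]
      ring
    · exact hFd.continuousOn.comp (continuous_ray s).continuousOn fun r hr =>
        ray_mem_sector hr hspi (hs ▸ hθ)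
  have hvert : ∀ e : ℝ → ℝ, (∀ᶠ R in atTop, 2 * l ≤ Real.exp (e R) ∨ Real.exp (e R) ≤ l / 2) →
      Tendsto (fun R => B (Real.exp (e R))) atTop (𝓝 0) →
      Tendsto (fun R => Complex.I • ∫ y in (-θ)..θ, g ((e R : ℝ) + y * Complex.I)) atTop
        (𝓝 0) := fun e he hBe => by
    have h2 : Tendsto (fun R => 2 * B (Real.exp (e R)) * |θ - -θ|) atTop (𝓝 0) := by
      simpa using (hBe.const_mul 2).mul_const |θ - -θ|
    refine squeeze_zero_norm' (he.mono fun R hR => ?_) h2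
    rw [norm_smul, Complex.norm_I, one_mul]
    refine intervalIntegral.norm_integral_le_of_norm_le_const fun y hy => ?_
    rw [uIoc_of_le (by linarith)] at hy
    have hmem : Complex.exp (((e R : ℝ) : ℂ) + y * Complex.I) ∈ sector σ :=
      exp_mem_sector hσ (abs_lt.2 ⟨by linarith [hy.1], by linarith [hy.2]⟩)
    have h3 := norm_dslope_mul_le hl hul (z := Complex.exp (((e R : ℝ) : ℂ) + y * Complex.I))
      (by rwa [norm_exp_add_mul_I])
    have h4 := hB _ hmem
    rw [norm_exp_add_mul_I] at h4
    exact h3.trans (by linarith)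
  have hexpneg : Tendsto (fun R : ℝ => Real.exp (-R)) atTop (𝓝 0) :=
    Real.tendsto_exp_atBot.comp tendsto_neg_atTop_atBot
  have hright := hvert (fun R => R)
    ((Real.tendsto_exp_atTop.eventually_ge_atTop (2 * l)).mono fun R h => Or.inl h)
    (hBtop.comp Real.tendsto_exp_atTop)
  have hleft := hvert (fun R => -R)
    ((hexpneg.eventually_le_const (half_pos hl)).mono fun R h => Or.inr h) (hB0.comp hexpneg)
  have hlim := (((hhor (-θ) (by rw [abs_neg, abs_of_pos hθ0])).sub
    (hhor θ (abs_of_pos hθ0))).add hright).sub hleft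
  have hzero : ∀ R : ℝ, (∫ x in (-R)..R, g (x + (-θ : ℝ) * Complex.I)) -
      (∫ x in (-R)..R, g (x + θ * Complex.I)) +
      (Complex.I • ∫ y in (-θ)..θ, g ((R : ℝ) + y * Complex.I)) -
      (Complex.I • ∫ y in (-θ)..θ, g ((-R : ℝ) + y * Complex.I)) = 0 := fun R => by
    have h := Complex.integral_boundary_rect_eq_zero_of_differentiableOn g
      (⟨-R, -θ⟩ : ℂ) (⟨R, θ⟩ : ℂ) ?_
    · exact h
    · refine (hFd.comp Complex.differentiable_exp.differentiableOn fun w hw => ?_).mul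
        Complex.differentiable_exp.differentiableOn
      have hw2 : w.im ∈ uIcc (-θ) θ := hw.2
      rw [uIcc_of_le (by linarith), mem_Icc] at hw2
      rw [← Complex.re_add_im w]
      exact exp_mem_sector hσ (abs_lt.2 ⟨by linarith, by linarith⟩)
  have h0 := tendsto_nhds_unique (hlim.congr hzero) tendsto_const_nhds
  rw [add_zero, sub_zero] at h0
  exact sub_eq_zero.1 h0

end Cauchy

/-! ### An explicit Cauchy integral and Cauchy's formula -/

section Kernel

variable {σ θ l : ℝ}

/-- A function of class `H^∞_0` with value `1` at `l` whose Cauchy integral is explicit. -/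
def cauchyKernel (l : ℝ) (z : ℂ) : ℂ := 4 * l * z / (z + l) ^ 2

lemma cauchyKernel_self (hl : 0 < l) : cauchyKernel l l = 1 := by
  have : (l : ℂ) ≠ 0 := by exact_mod_cast hl.ne'
  rw [cauchyKernel]
  field_simp
  norm_num

lemma re_pos_of_mem_sector (hσ : σ ≤ Real.pi / 2) {z : ℂ} (hz : z ∈ sector σ) : 0 < z.re :=
  (Complex.abs_arg_lt_pi_div_two_iff.1 (hz.2.trans_le hσ)).resolve_right hz.1

lemma sq_add_sq_le_norm_add (hl : 0 < l) {z : ℂ} (hz : 0 ≤ z.re) :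
    ‖z‖ ^ 2 + l ^ 2 ≤ ‖z + l‖ ^ 2 := by
  rw [← Complex.normSq_eq_norm_sq, ← Complex.normSq_eq_norm_sq, Complex.normSq_apply,
    Complex.normSq_apply]
  simp only [Complex.add_re, Complex.add_im, Complex.ofReal_re, Complex.ofReal_im, add_zero]
  nlinarith [mul_nonneg hz hl.le]

lemma add_ne_zero_of_re_nonneg (hl : 0 < l) {z : ℂ} (hz : 0 ≤ z.re) : z + l ≠ 0 := fun h => by
  have := sq_add_sq_le_norm_add hl hz
  rw [h, norm_zero] at this
  nlinarith [sq_nonneg ‖z‖]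

lemma isHInftyZero_cauchyKernel (hσ : σ ≤ Real.pi / 2) (hl : 0 < l) :
    IsHInftyZero σ (cauchyKernel l) := by
  have hne : ∀ z ∈ sector σ, z + l ≠ 0 := fun z hz =>
    add_ne_zero_of_re_nonneg hl (re_pos_of_mem_sector hσ hz).le
  refine ⟨fun z hz => ?_, 4 * l * (1 + 1 / l ^ 2), 1, one_pos, fun z hz => ?_⟩
  · have h : DifferentiableAt ℂ (fun z : ℂ => 4 * l * z / (z + l) ^ 2) z :=
      DifferentiableAt.fun_div (by fun_prop) (by fun_prop) (pow_ne_zero 2 (hne z hz))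
    exact h.differentiableWithinAt
  · have h1 := sq_add_sq_le_norm_add hl (re_pos_of_mem_sector hσ hz).le
    have h2 : 0 < ‖z + l‖ ^ 2 := by
      have := norm_pos_iff.2 (hne z hz)
      positivity
    rw [cauchyKernel, norm_div, norm_mul, norm_mul, norm_pow, Real.rpow_one, Real.rpow_one,
      Complex.norm_real, Real.norm_of_nonneg hl.le, Complex.norm_ofNat, div_le_div_iff₀ h2
      (by positivity)]
    have h3 : 1 + ‖z‖ ^ 2 ≤ (1 + 1 / l ^ 2) * ‖z + l‖ ^ 2 := by
      calc 1 + ‖z‖ ^ 2 ≤ (1 + 1 / l ^ 2) * (‖z‖ ^ 2 + l ^ 2) := by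
            have : 1 / l ^ 2 * l ^ 2 = 1 := by field_simp
            have h4 : 0 ≤ 1 / l ^ 2 * ‖z‖ ^ 2 := by positivity
            nlinarith [sq_nonneg l]
        _ ≤ _ := by gcongr
    calc 4 * l * ‖z‖ * (1 + ‖z‖ ^ 2) ≤ 4 * l * ‖z‖ * ((1 + 1 / l ^ 2) * ‖z + l‖ ^ 2) := by gcongr
      _ = _ := by ring

/-- The rotation `c` drops out of the derivative; it is free to move `(z - l)/(z + l)` off the
branch cut of the logarithm. -/
lemma hasDerivAt_kernel_primitive {c z : ℂ} (hc : c ≠ 0) (h1 : z - l ≠ 0) (h2 : z + l ≠ 0)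
    (hs : c * ((z - l) / (z + l)) ∈ Complex.slitPlane) :
    HasDerivAt (fun z : ℂ => Complex.log (c * ((z - l) / (z + l))) - 2 * l / (z + l))
      (cauchyKernel l z * (z - l)⁻¹) z := by
  have hd1 : HasDerivAt (fun z : ℂ => z - l) 1 z := (hasDerivAt_id z).sub_const _
  have hd2 : HasDerivAt (fun z : ℂ => z + l) 1 z := (hasDerivAt_id z).add_const _
  have h3 := (((hd1.div hd2 h2).const_mul c).clog hs).sub ((hasDerivAt_const z (2 * (l : ℂ))).div hd2 h2)
  refine h3.congr_deriv ?_
  simp only [Pi.div_apply]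
  rw [cauchyKernel]
  field_simp
  ring

lemma im_kernel_quotient (z : ℂ) :
    ((z - l) / (z + l)).im = 2 * l * z.im / Complex.normSq (z + l) := by
  rw [Complex.div_im]
  simp only [Complex.sub_re, Complex.sub_im, Complex.add_re, Complex.add_im, Complex.ofReal_re,
    Complex.ofReal_im, add_zero, sub_zero]
  ring

/-- The fundamental theorem of calculus along the ray: `(z - l)/(z + l)` runs from `-1` to `1`
inside one half-plane, so the logarithm changes by `-sπi`, while `-2l/(z + l)` rises from `-2` to
`0`. Here `s` is the sign of `θ`. -/
lemma cauchyRay_cauchyKernel (hθ0 : θ ≠ 0) (hθ : |θ| < Real.pi / 2) (hl : 0 < l) {s : ℝ}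
    (hs : s = 1 ∨ s = -1) (hsθ : 0 < s * θ) :
    cauchyRay (cauchyKernel l) l θ = 2 - s * Real.pi * Complex.I := by
  have hpi : |θ| < Real.pi := by linarith [Real.pi_pos]
  obtain ⟨σ, hθσ, hσ⟩ := exists_between hθ
  have hlc : (l : ℂ) ≠ 0 := by exact_mod_cast hl.ne'
  -- Rotates the half-plane containing the quotient onto the right half-plane.
  set c : ℂ := -(s * Complex.I) with hc
  have hc0 : c ≠ 0 := by rcases hs with rfl | rfl <;> simp [hc]
  have hcneg : c * -1 = s * Complex.I := by rw [hc]; ring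
  -- The limits `-1` and `1` of the quotient are rotated to `± i`, where the logarithm is still
  -- continuous; hence both endpoint values can be read off.
  have hsl : c * -1 ∈ Complex.slitPlane ∧ c * 1 ∈ Complex.slitPlane := by
    rcases hs with rfl | rfl <;> simp [hc, Complex.mem_slitPlane_iff]
  set z : ℝ → ℂ := fun r => r * Complex.exp (θ * Complex.I) with hz
  have hzc : Continuous z := continuous_ray θ
  have hzre : ∀ r, 0 ≤ r → 0 ≤ (z r).re := fun r hr => by
    rw [hz, ray_re]
    exact mul_nonneg hr (Real.cos_nonneg_of_mem_Icc ⟨by linarith [neg_abs_le θ], by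
      linarith [le_abs_self θ]⟩)
  have hadd : ∀ r, 0 ≤ r → z r + l ≠ 0 := fun r hr => add_ne_zero_of_re_nonneg hl (hzre r hr)
  have hz0 : z 0 = 0 := by simp [hz]
  have hsin : 0 < s * Real.sin θ := by
    rcases hs with rfl | rfl
    · rw [one_mul] at hsθ ⊢
      exact Real.sin_pos_of_pos_of_lt_pi hsθ (by linarith [le_abs_self θ])
    · rw [neg_one_mul] at hsθ ⊢
      rw [← Real.sin_neg]
      exact Real.sin_pos_of_pos_of_lt_pi hsθ (by linarith [neg_le_abs θ])
  have hslit : ∀ r, 0 < r → c * ((z r - l) / (z r + l)) ∈ Complex.slitPlane := fun r hr => by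
    refine Or.inl ?_
    have h1 : (c * ((z r - l) / (z r + l))).re = s * ((z r - l) / (z r + l)).im := by
      rw [hc, Complex.mul_re]
      simp
    rw [h1, im_kernel_quotient, hz, ray_im]
    have h2 := Complex.normSq_pos.2 (hadd r hr.le)
    calc 0 < 2 * l * r * (s * Real.sin θ) / Complex.normSq (z r + l) := by positivity
      _ = _ := by ring
  set G : ℝ → ℂ := fun r => Complex.log (c * ((z r - l) / (z r + l))) - 2 * l / (z r + l) with hG
  have hderiv : ∀ r ∈ Ioi (0 : ℝ), HasDerivAt G
      ((cauchyKernel l (r * Complex.exp (θ * Complex.I)) * Complex.exp (θ * Complex.I)) •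
        ((r : ℂ) * Complex.exp (θ * Complex.I) - l)⁻¹) r := fun r hr => by
    have h1 := hasDerivAt_kernel_primitive hc0 (ray_sub_ne_zero hθ0 hpi hl hr)
      (hadd r (le_of_lt hr)) (hslit r hr)
    have h2 : HasDerivAt z (Complex.exp (θ * Complex.I)) r := by
      simpa using (Complex.ofRealCLM.hasDerivAt (x := r)).mul_const (Complex.exp (θ * Complex.I))
    refine (h1.comp r h2).congr_deriv ?_
    rw [smul_eq_mul]
    ring
  have hcont : ContinuousWithinAt G (Ici 0) 0 := by
    have h1 : ContinuousAt (fun r => (z r - l) / (z r + l)) 0 :=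
      ContinuousAt.div (by fun_prop) (by fun_prop) (hadd 0 le_rfl)
    have h2 : (z 0 - l) / (z 0 + l) = -1 := by
      rw [hz0, zero_sub, zero_add, neg_div, div_self hlc]
    refine ContinuousAt.continuousWithinAt (ContinuousAt.sub (ContinuousAt.clog (h1.const_mul c) ?_)
      (ContinuousAt.div (by fun_prop) (by fun_prop) (hadd 0 le_rfl)))
    rw [h2]
    exact hsl.1
  have hinv : Tendsto (fun r => 2 * l / (z r + l)) atTop (𝓝 0) := by
    have h : Tendsto (fun r => z r + l) atTop (Bornology.cobounded ℂ) := by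
      rw [← tendsto_norm_atTop_iff_cobounded]
      refine tendsto_atTop_mono' atTop ((eventually_ge_atTop 0).mono fun r hr => ?_) tendsto_id
      have h1 := sq_add_sq_le_norm_add hl (hzre r hr)
      rw [hz, norm_ray hr] at h1
      exact abs_le_of_sq_le_sq' (by simp only [id]; nlinarith) (norm_nonneg _) |>.2
    simpa [div_eq_mul_inv] using (tendsto_inv₀_cobounded.comp h).const_mul (2 * (l : ℂ))
  have htop : Tendsto G atTop (𝓝 (Complex.log (c * 1) - 0)) := by
    refine Tendsto.sub (Tendsto.clog ?_ hsl.2) hinv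
    have h1 : Tendsto (fun r => 1 - 2 * l / (z r + l)) atTop (𝓝 (1 - 0)) := hinv.const_sub 1
    rw [sub_zero] at h1
    refine (h1.congr' ((eventually_ge_atTop 0).mono fun r hr => ?_)).const_mul c
    have := hadd r hr
    field_simp
    ring
  have hint := integral_Ioi_of_hasDerivAt_of_tendsto hcont hderiv
    ((isHInftyZero_cauchyKernel hσ.le hl).integrableOn_cauchyRay hθ0 hθσ
      (by linarith [Real.pi_pos]) hl) htop
  rw [cauchyRay, hint, hG]
  simp only [hz0, zero_sub, zero_add, sub_zero]
  rw [neg_div, div_self hlc, mul_div_cancel_right₀ _ hlc, hcneg, mul_one, hc]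
  rcases hs with rfl | rfl
  · simp only [Complex.ofReal_one, one_mul, Complex.log_I, Complex.log_neg_I]
    ring
  · simp only [Complex.ofReal_neg, Complex.ofReal_one, neg_mul, one_mul, neg_neg, Complex.log_I,
      Complex.log_neg_I]
    ring

/-- Cauchy's formula on a sector. -/
lemma IsHInftyZero.cauchyRay_sub {φ : ℂ → ℂ} (h : IsHInftyZero σ φ) (hσ : σ < Real.pi / 2)
    (hl : 0 < l) (hθ0 : 0 < θ) (hθ : θ < σ) :
    cauchyRay φ l (-θ) - cauchyRay φ l θ = 2 * Real.pi * Complex.I * φ l := by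
  have hπ : σ < Real.pi := by linarith [Real.pi_pos]
  have hk := isHInftyZero_cauchyKernel hσ.le hl
  -- Subtracting a multiple of the kernel makes the function vanish at the pole `l` and keeps the
  -- decay at `0` and infinity. What is left of the formula is the explicit integral of the kernel,
  -- where `(2 + πi) - (2 - πi) = 2πi`.
  set u : ℂ → ℂ := fun z => φ z - φ l * cauchyKernel l z with hu
  have hsplit : ∀ s : ℝ, (fun r : ℝ => (u (r * Complex.exp (s * Complex.I)) *
      Complex.exp (s * Complex.I)) • ((r : ℂ) * Complex.exp (s * Complex.I) - l)⁻¹) =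
      fun r : ℝ => (φ (r * Complex.exp (s * Complex.I)) *
      Complex.exp (s * Complex.I)) • ((r : ℂ) * Complex.exp (s * Complex.I) - l)⁻¹ -
      φ l * ((cauchyKernel l (r * Complex.exp (s * Complex.I)) *
      Complex.exp (s * Complex.I)) • ((r : ℂ) * Complex.exp (s * Complex.I) - l)⁻¹) := fun s => by
    funext r
    simp only [hu, smul_eq_mul]
    ring
  have hint : ∀ s : ℝ, |s| = θ → _ ∧ _ := fun s hs =>
    have hs0 : s ≠ 0 := abs_pos.1 (hs ▸ hθ0)
    And.intro (h.integrableOn_cauchyRay hs0 (hs ▸ hθ) hπ hl)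
      ((hk.integrableOn_cauchyRay hs0 (hs ▸ hθ) hπ hl).const_mul (φ l))
  have hdecomp : ∀ s : ℝ, |s| = θ →
      cauchyRay u l s = cauchyRay φ l s - φ l * cauchyRay (cauchyKernel l) l s := fun s hs => by
    rw [cauchyRay, hsplit, integral_sub (hint s hs).1 (hint s hs).2, integral_const_mul]
    rfl
  obtain ⟨C, ε, -, hε, hC⟩ := h.exists_bound
  obtain ⟨C', ε', -, hε', hC'⟩ := hk.exists_bound
  have hlim : ∀ L : Filter ℝ, Tendsto (fun r : ℝ => r / (1 + r ^ 2)) L (𝓝 0) →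
      Tendsto (fun r : ℝ => C * (r / (1 + r ^ 2)) ^ ε +
        ‖φ l‖ * (C' * (r / (1 + r ^ 2)) ^ ε')) L (𝓝 0) := fun L hL => by
    simpa using (tendsto_const_mul_rpow_zero hL C hε).add
      ((tendsto_const_mul_rpow_zero hL C' hε').const_mul ‖φ l‖)
  have heq : cauchyRay u l (-θ) = cauchyRay u l θ := by
    refine cauchyRay_neg_eq (h.1.sub (hk.1.const_mul _)) hπ hl ?_ hθ0 hθ (fun z hz => ?_)
      (hlim _ tendsto_div_one_add_sq_zero) (hlim _ tendsto_div_one_add_sq_atTop) fun s hs => ?_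
    · simp only [hu, cauchyKernel_self hl, mul_one, sub_self]
    · refine (norm_sub_le _ _).trans (add_le_add (hC z hz) ?_)
      rw [norm_mul]
      gcongr
      exact hC' z hz
    · rw [hsplit]
      exact (hint s hs).1.sub (hint s hs).2
  have hθabs : |θ| = θ := abs_of_pos hθ0
  have hnegabs : |-θ| = θ := by rw [abs_neg, hθabs]
  rw [hdecomp _ hθabs, hdecomp _ hnegabs, cauchyRay_cauchyKernel (s := 1) hθ0.ne'
    (by rw [hθabs]; linarith) hl (Or.inl rfl) (by linarith),
    cauchyRay_cauchyKernel (s := -1) (neg_ne_zero.2 hθ0.ne')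
    (by rw [hnegabs]; linarith) hl (Or.inr rfl) (by linarith)] at heq
  push_cast at heq
  linear_combination heq

end Kernel

/-! ### Analytic extension of the semigroup -/

section Analytic

variable {q : ℝ≥0∞} [Fact (1 ≤ q)] {lam : ℕ → ℝ}

lemma norm_cexp_neg_mul (z : ℂ) (c : ℝ) :
    ‖Complex.exp (-(z * c))‖ = Real.exp (-(z.re * c)) := by
  rw [Complex.norm_exp, Complex.neg_re, Complex.re_mul_ofReal]

lemma norm_cexp_neg_mul_le (hpos : ∀ k, 0 < lam k) {z : ℂ} (hz : 0 < z.re) (k : ℕ) :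
    ‖Complex.exp (-(z * lam k))‖ ≤ 1 := by
  rw [norm_cexp_neg_mul, Real.exp_le_one_iff]
  have := mul_pos hz (hpos k)
  linarith

lemma mul_exp_neg_le {a c : ℝ} (ha : 0 < a) : c * Real.exp (-(a * c)) ≤ a⁻¹ := by
  rw [Real.exp_neg, ← div_eq_mul_inv, div_le_iff₀ (Real.exp_pos _), ← div_eq_inv_mul, le_div_iff₀ ha]
  linarith [Real.add_one_le_exp (a * c)]

lemma sq_mul_exp_neg_le {a c : ℝ} (ha : 0 < a) (hc : 0 ≤ c) :
    c ^ 2 * Real.exp (-(a / 2 * c)) ≤ ((a / 4)⁻¹) ^ 2 := by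
  have h := mul_exp_neg_le (a := a / 4) (c := c) (by positivity)
  calc c ^ 2 * Real.exp (-(a / 2 * c)) = (c * Real.exp (-(a / 4 * c))) ^ 2 := by
        rw [mul_pow, ← Real.exp_nat_mul]
        congr 2
        push_cast
        ring
    _ ≤ _ := by gcongr

/-- The point is uniformity in `c`, that is, in the eigenvalue. The remainder is at most `c² |w -
z|² e^{-c Re z} e^{c |w - z|}`, and the restriction `|w - z| ≤ Re z / 2` leaves a factor `e^{-c Re z
/ 2}` to absorb `c²`. It yields differentiability in operator norm. -/
lemma norm_cexp_taylor_le {z w : ℂ} {c : ℝ} (hc : 0 ≤ c) (hz : 0 < z.re)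
    (hw : ‖w - z‖ ≤ z.re / 2) :
    ‖Complex.exp (-(w * c)) - Complex.exp (-(z * c)) -
      (w - z) * (-c * Complex.exp (-(z * c)))‖ ≤ ((z.re / 4)⁻¹) ^ 2 * ‖w - z‖ ^ 2 := by
  have h := Complex.norm_exp_sub_sum_le_norm_mul_exp (-((w - z) * c)) 2
  simp only [Finset.sum_range_succ, Finset.range_zero, Finset.sum_empty, pow_zero, Nat.factorial_zero,
    Nat.cast_one, div_one, zero_add, pow_one, Nat.factorial_one, norm_neg, norm_mul,
    Complex.norm_real, Real.norm_of_nonneg hc] at h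
  have h1 : Complex.exp (-(w * c)) - Complex.exp (-(z * c)) -
      (w - z) * (-c * Complex.exp (-(z * c))) =
      Complex.exp (-(z * c)) * (Complex.exp (-((w - z) * c)) - (1 + -((w - z) * c))) := by
    have : Complex.exp (-(w * c)) = Complex.exp (-(z * c)) * Complex.exp (-((w - z) * c)) := by
      rw [← Complex.exp_add]
      ring_nf
    rw [this]
    ring
  rw [h1, norm_mul, norm_cexp_neg_mul]
  calc Real.exp (-(z.re * c)) * ‖Complex.exp (-((w - z) * c)) - (1 + -((w - z) * c))‖
      ≤ Real.exp (-(z.re * c)) * ((‖w - z‖ * c) ^ 2 * Real.exp (z.re / 2 * c)) := by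
        refine mul_le_mul_of_nonneg_left (h.trans ?_) (Real.exp_pos _).le
        gcongr
    _ = c ^ 2 * Real.exp (-(z.re / 2 * c)) * ‖w - z‖ ^ 2 := by
        have : Real.exp (-(z.re / 2 * c)) = Real.exp (-(z.re * c)) * Real.exp (z.re / 2 * c) := by
          rw [← Real.exp_add]
          ring_nf
        rw [this]
        ring
    _ ≤ _ := by
        gcongr
        exact sq_mul_exp_neg_le hz hc

lemma hasDerivAt_mulCLM_cexp (hpos : ∀ k, 0 < lam k) {z : ℂ} (hz : 0 < z.re) :
    HasDerivAt (fun z : ℂ => mulCLM q fun k => Complex.exp (-(z * lam k)))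
      (mulCLM q fun k => -(lam k : ℂ) * Complex.exp (-(z * lam k))) z := by
  have hbound : ∀ {w : ℂ}, 0 < w.re → IsMultiplier fun k => Complex.exp (-(w * lam k)) :=
    fun hw => ⟨1, norm_cexp_neg_mul_le hpos hw⟩
  have hD : IsMultiplier fun k => -(lam k : ℂ) * Complex.exp (-(z * lam k)) := by
    refine ⟨z.re⁻¹, fun k => ?_⟩
    rw [norm_mul, norm_neg, Complex.norm_real, Real.norm_of_nonneg (hpos k).le, norm_cexp_neg_mul]
    exact mul_exp_neg_le hz
  rw [hasDerivAt_iff_isLittleO]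
  refine Asymptotics.IsBigO.trans_isLittleO (g := fun w : ℂ => ‖w - z‖ ^ 2) ?_ ?_
  · refine Asymptotics.IsBigO.of_bound (((z.re / 4)⁻¹) ^ 2) ?_
    filter_upwards [Metric.closedBall_mem_nhds z (half_pos hz)] with w hw
    rw [Metric.mem_closedBall, dist_eq_norm] at hw
    have hwre : 0 < w.re := by
      have h1 := (Complex.abs_re_le_norm (w - z)).trans hw
      rw [Complex.sub_re] at h1
      linarith [neg_abs_le (w.re - z.re)]
    rw [mulCLM_sub (hbound hwre) (hbound hz), smul_mulCLM hD,
      mulCLM_sub ((hbound hwre).sub (hbound hz)) (hD.const_mul _), norm_pow, norm_norm]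
    exact norm_mulCLM_le fun k => norm_cexp_taylor_le (hpos k).le hz hw
  · exact Asymptotics.isLittleO_pow_sub_sub z one_lt_two

lemma isBoundedAnalytic_diagSemigroup (hq : q < ∞) (hpos : ∀ k, 0 < lam k) :
    IsBoundedAnalytic (diagSemigroup ℂ q lam) := by
  have hre : ∀ {z : ℂ}, z ∈ sector (Real.pi / 2) → 0 < z.re := fun hz =>
    re_pos_of_mem_sector le_rfl hz
  refine ⟨Real.pi / 2, by positivity, le_rfl,
    fun z => mulCLM q fun k => Complex.exp (-(z * lam k)), ?_, ?_, ?_, ?_, ?_⟩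
  · exact fun z hz => (hasDerivAt_mulCLM_cexp hpos (hre hz)).differentiableAt.differentiableWithinAt
  · intro t _
    beta_reduce
    rw [diagSemigroup]
    congr 1
    funext k
    have h : Complex.exp (-(t * lam k)) = ((Real.exp (-(t * lam k)) : ℝ) : ℂ) := by push_cast; rfl
    exact h
  · intro z hz w hw
    have hzw : 0 < (z + w).re := add_pos (hre hz) (hre hw)
    symm
    refine mulCLM_ext ⟨1, norm_cexp_neg_mul_le hpos hzw⟩ fun x k => ?_
    rw [ContinuousLinearMap.comp_apply, mulCLM_apply ⟨1, norm_cexp_neg_mul_le hpos (hre hz)⟩,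
      mulCLM_apply ⟨1, norm_cexp_neg_mul_le hpos (hre hw)⟩, ← mul_assoc, ← Complex.exp_add]
    ring_nf
  · exact ⟨1, fun z hz => norm_mulCLM_le (norm_cexp_neg_mul_le hpos (hre hz))⟩
  · intro x
    have h1 : mulCLM q (fun _ => (1 : ℂ)) x = x := by
      ext k
      rw [mulCLM_apply ⟨1, fun _ => by simp⟩, one_mul]
    have := tendsto_mulCLM hq (l := 𝓝[sector (Real.pi / 2)] (0 : ℂ))
      (m := fun z k => Complex.exp (-(z * lam k))) (m₀ := fun _ => 1) (M := 1)
      (eventually_mem_nhdsWithin.mono fun z hz => norm_cexp_neg_mul_le hpos (hre hz))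
      (fun _ => by simp) (fun k => ?_) x
    · rwa [h1] at this
    · have hc : Continuous fun z : ℂ => Complex.exp (-(z * lam k)) := by fun_prop
      have := hc.tendsto 0
      simp only [zero_mul, neg_zero, Complex.exp_zero] at this
      exact this.mono_left nhdsWithin_le_nhds

end Analytic

/-! ### Sectoriality and the `H^∞`-calculus of the diagonal operator -/

section Sectorial

variable {q : ℝ≥0∞} [Fact (1 ≤ q)] {lam : ℕ → ℝ}

/-- The truncations of `y` converge to `y` and lie in the range, because `λ_k⁻¹` is bounded on
finitely many indices. -/
lemma denseRange_diagOp (hq : q < ∞) (hpos : ∀ k, 0 < lam k) :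
    DenseRange fun x : (diagOp ℂ q lam).domain => diagOp ℂ q lam x := by
  intro y
  have hle : ∀ n k : ℕ, ‖(if k < n then (1 : ℂ) else 0)‖ ≤ 1 := fun n k => by
    split_ifs <;> simp
  have hlim : Tendsto (fun n : ℕ => mulCLM q (fun k => if k < n then (1 : ℂ) else 0) y) atTop
      (𝓝 (mulCLM q (fun _ => (1 : ℂ)) y)) := by
    refine tendsto_mulCLM hq (M := 1) (Eventually.of_forall hle) (fun _ => by simp) (fun k => ?_) y
    refine tendsto_const_nhds.congr' ((eventually_gt_atTop k).mono fun n hn => ?_)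
    exact (if_pos hn).symm
  have h1 : mulCLM q (fun _ => (1 : ℂ)) y = y := by
    ext k
    rw [mulCLM_apply ⟨1, fun _ => by simp⟩, one_mul]
  rw [h1] at hlim
  refine mem_closure_of_tendsto hlim (Eventually.of_forall fun n => ?_)
  have hm : IsMultiplier fun k => if k < n then ((lam k : ℂ))⁻¹ else 0 := by
    refine ⟨∑ i ∈ Finset.range n, ‖((lam i : ℂ))⁻¹‖, fun k => ?_⟩
    beta_reduce
    split_ifs with h
    · exact Finset.single_le_sum (f := fun i => ‖((lam i : ℂ))⁻¹‖) (fun _ _ => norm_nonneg _)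
        (Finset.mem_range.2 h)
    · rw [norm_zero]
      exact Finset.sum_nonneg fun _ _ => norm_nonneg _
  have hval : ∀ k, (lam k : ℂ) * mulCLM q (fun k => if k < n then ((lam k : ℂ))⁻¹ else 0) y k =
      mulCLM q (fun k => if k < n then (1 : ℂ) else 0) y k := fun k => by
    have hne : (lam k : ℂ) ≠ 0 := by exact_mod_cast (hpos k).ne'
    rw [mulCLM_apply hm, mulCLM_apply ⟨1, hle n⟩]
    split_ifs
    · field_simp
    · simp
  refine ⟨⟨mulCLM q (fun k => if k < n then ((lam k : ℂ))⁻¹ else 0) y, ?_⟩, ?_⟩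
  · rw [mem_domain_diagOp]
    exact (funext hval) ▸ lp.memℓp _
  · ext k
    exact hval k

lemma injective_diagOp (hpos : ∀ k, 0 < lam k) (x : (diagOp ℂ q lam).domain)
    (hx : diagOp ℂ q lam x = 0) : x = 0 := by
  refine Subtype.ext (lp.ext (funext fun k => ?_))
  have h : (lam k : ℂ) * (x : ell ℂ q) k = 0 := by
    rw [← RCLike.ofReal_eq_complex_ofReal, ← diagOp_apply, hx]
    rfl
  exact (mul_eq_zero.1 h).resolve_left (by exact_mod_cast (hpos k).ne')

lemma isSectorial_diagOp (hpos : ∀ k, 0 < lam k) {σ₀ : ℝ} (hσ₀ : 0 < σ₀) :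
    IsSectorial (diagOp ℂ q lam) σ₀ := by
  constructor
  · rw [compl_subset_comm]
    intro z hz
    obtain ⟨d, hd, hball⟩ := Metric.isOpen_iff.1 isClosed_closure.isOpen_compl z hz
    refine ⟨_, isResolventAt_diagOp hd fun k => ?_⟩
    by_contra! h
    have h1 : (lam k : ℂ) ∈ Metric.ball z d := by
      rwa [Metric.mem_ball, dist_comm, dist_eq_norm]
    exact hball h1 (subset_closure (ofReal_mem_sector hσ₀ (hpos k)))
  · intro σ hσ hσπ
    have hσ0 : 0 < σ := hσ₀.trans hσ
    have hsin := Real.sin_pos_of_pos_of_lt_pi hσ0 hσπ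
    refine ⟨(Real.sin σ)⁻¹, fun z hz => ?_⟩
    rcases eq_or_ne z 0 with rfl | h0
    · rw [zero_smul, norm_zero]
      positivity
    have hz0 : 0 < ‖z‖ := norm_pos_iff.2 h0
    have hd : 0 < Real.sin σ * ‖z‖ := by positivity
    have hk : ∀ k, Real.sin σ * ‖z‖ ≤ ‖z - (lam k : ℂ)‖ := fun k =>
      sin_mul_norm_le_norm_sub hσ0 hσπ (hpos k) hz
    rw [resolventOp_diagOp hd hk, norm_smul]
    calc ‖z‖ * _ ≤ ‖z‖ * (Real.sin σ * ‖z‖)⁻¹ := by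
          gcongr
          exact norm_mulCLM_le (isMultiplier_inv_sub hd hk)
      _ = _ := by field_simp

variable {θ σ : ℝ} {φ : ℂ → ℂ}

lemma resolventOp_ray (hpos : ∀ k, 0 < lam k) (hθ0 : θ ≠ 0) (hθ : |θ| < Real.pi) {r : ℝ}
    (hr : 0 < r) : resolventOp (diagOp ℂ q lam) (r * Complex.exp (θ * Complex.I)) =
      mulCLM q fun k => ((r : ℂ) * Complex.exp (θ * Complex.I) - lam k)⁻¹ :=
  resolventOp_diagOp (mul_pos (sin_abs_pos hθ0 hθ) hr)
    fun k => mul_le_norm_ray_sub hθ0 hθ (hpos k) hr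

lemma isMultiplier_ray (hpos : ∀ k, 0 < lam k) (hθ0 : θ ≠ 0) (hθ : |θ| < Real.pi) {r : ℝ}
    (hr : 0 < r) : IsMultiplier fun k => ((r : ℂ) * Complex.exp (θ * Complex.I) - lam k)⁻¹ :=
  ⟨_, fun k => norm_inv_ray_sub_le hθ0 hθ (hpos k) hr⟩

/-- The resolvent identity in each coordinate, with bounds independent of the coordinate, gives
continuity in operator norm. This supplies the measurability of the operator-valued integrand. -/
lemma continuousOn_resolventOp_ray (hpos : ∀ k, 0 < lam k) (hθ0 : θ ≠ 0) (hθ : |θ| < Real.pi) :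
    ContinuousOn (fun r : ℝ => resolventOp (diagOp ℂ q lam) (r * Complex.exp (θ * Complex.I)))
      (Ioi 0) := by
  intro r₀ hr₀
  have hr₀ : 0 < r₀ := hr₀
  set s := Real.sin |θ| with hs
  rw [ContinuousWithinAt, ← tendsto_sub_nhds_zero_iff]
  have hlim : Tendsto (fun r : ℝ => |r₀ - r| * (s⁻¹ * r⁻¹) * (s⁻¹ * r₀⁻¹)) (𝓝[Ioi 0] r₀) (𝓝 0) := by
    have h1 : ContinuousAt (fun r : ℝ => |r₀ - r| * (s⁻¹ * r⁻¹) * (s⁻¹ * r₀⁻¹)) r₀ :=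
      (((continuousAt_const.sub continuousAt_id).abs).mul
        (continuousAt_const.mul (continuousAt_inv₀ hr₀.ne'))).mul continuousAt_const
    have h2 := h1.tendsto
    simp only [sub_self, abs_zero, zero_mul] at h2
    exact h2.mono_left nhdsWithin_le_nhds
  refine squeeze_zero_norm' (eventually_mem_nhdsWithin.mono fun r hr => ?_) hlim
  have hr : 0 < r := hr
  rw [resolventOp_ray hpos hθ0 hθ hr, resolventOp_ray hpos hθ0 hθ hr₀,
    mulCLM_sub (isMultiplier_ray hpos hθ0 hθ hr) (isMultiplier_ray hpos hθ0 hθ hr₀)]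
  refine norm_mulCLM_le fun k => ?_
  have h1 := ray_sub_ne_zero hθ0 hθ (hpos k) hr
  have h2 := ray_sub_ne_zero hθ0 hθ (hpos k) hr₀
  have h3 : ((r : ℂ) * Complex.exp (θ * Complex.I) - lam k)⁻¹ -
      ((r₀ : ℂ) * Complex.exp (θ * Complex.I) - lam k)⁻¹ =
      ((r₀ - r : ℝ) : ℂ) * Complex.exp (θ * Complex.I) *
        ((r : ℂ) * Complex.exp (θ * Complex.I) - lam k)⁻¹ *
        ((r₀ : ℂ) * Complex.exp (θ * Complex.I) - lam k)⁻¹ := by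
    rw [inv_sub_inv h1 h2, div_eq_mul_inv, mul_inv]
    push_cast
    ring
  rw [h3, norm_mul, norm_mul, norm_mul, Complex.norm_exp_ofReal_mul_I, mul_one, Complex.norm_real,
    Real.norm_eq_abs]
  have hspos : 0 < s := sin_abs_pos hθ0 hθ
  gcongr
  · exact norm_inv_ray_sub_le hθ0 hθ (hpos k) hr
  · exact norm_inv_ray_sub_le hθ0 hθ (hpos k) hr₀

/-- Evaluation at `x` followed by the `k`-th coordinate is a bounded functional on operators, so it
passes through the Bochner integral once integrability in operator norm is known. -/
lemma rayIntegral_diagOp_apply (hpos : ∀ k, 0 < lam k) (hφ : IsHInftyZero σ φ) (hσ : σ < Real.pi)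
    (hθ0 : θ ≠ 0) (hθ : |θ| < σ) (x : ell ℂ q) (k : ℕ) :
    rayIntegral (diagOp ℂ q lam) θ φ x k = cauchyRay φ (lam k) θ * x k := by
  have hθπ : |θ| < Real.pi := hθ.trans hσ
  have hint := hφ.integrableOn_ray hθ hσ (continuousOn_resolventOp_ray (q := q) hpos hθ0 hθπ)
    (M := (Real.sin |θ|)⁻¹) fun r hr => by
      rw [resolventOp_ray hpos hθ0 hθπ hr]
      exact norm_mulCLM_le fun k => norm_inv_ray_sub_le hθ0 hθπ (hpos k) hr
  set L : (ell ℂ q →L[ℂ] ell ℂ q) →L[ℂ] ℂ :=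
    (lp.evalCLM ℂ (fun _ : ℕ => ℂ) q k).comp (ContinuousLinearMap.apply ℂ (ell ℂ q) x) with hL
  have h1 : rayIntegral (diagOp ℂ q lam) θ φ x k = L (rayIntegral (diagOp ℂ q lam) θ φ) := rfl
  refine (h1.trans (L.integral_comp_comm hint).symm).trans ?_
  rw [cauchyRay, ← integral_mul_const]
  refine setIntegral_congr_fun measurableSet_Ioi fun r hr => ?_
  have h2 : ∀ R : ell ℂ q →L[ℂ] ell ℂ q, L R = R x k := fun R => rfl
  beta_reduce
  rw [L.map_smul, h2, resolventOp_ray hpos hθ0 hθπ hr, mulCLM_apply (isMultiplier_ray hpos hθ0 hθπ hr),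
    smul_eq_mul, smul_eq_mul, mul_assoc _ _ (x k)]

lemma hInftyApply_diagOp_apply (hpos : ∀ k, 0 < lam k) (hφ : IsHInftyZero σ φ)
    (hσ : σ < Real.pi / 2) (hθ0 : 0 < θ) (hθ : θ < σ) (x : ell ℂ q) (k : ℕ) :
    hInftyApply (diagOp ℂ q lam) θ φ x k = φ (lam k) * x k := by
  have hπ : σ < Real.pi := by linarith [Real.pi_pos]
  have h0 : (2 * (Real.pi : ℂ) * Complex.I) ≠ 0 := Complex.two_pi_I_ne_zero
  have h1 : |θ| < σ := by rwa [abs_of_pos hθ0]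
  have h2 : hInftyApply (diagOp ℂ q lam) θ φ x k = (2 * (Real.pi : ℂ) * Complex.I)⁻¹ *
      (rayIntegral (diagOp ℂ q lam) (-θ) φ x k - rayIntegral (diagOp ℂ q lam) θ φ x k) := rfl
  rw [h2, rayIntegral_diagOp_apply hpos hφ hπ (neg_ne_zero.2 hθ0.ne') (by rwa [abs_neg]),
    rayIntegral_diagOp_apply hpos hφ hπ hθ0.ne' h1, ← sub_mul,
    hφ.cauchyRay_sub hσ (hpos k) hθ0 hθ, mul_assoc _ (φ _), inv_mul_cancel_left₀ h0]

lemma hasBoundedHInftyCalculus_diagOp (hq : q < ∞) (hpos : ∀ k, 0 < lam k) (hσ0 : 0 < σ)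
    (hσ : σ < Real.pi / 2) : HasBoundedHInftyCalculus (diagOp ℂ q lam) σ where
  pos := hσ0
  lt_pi := by linarith [Real.pi_pos]
  generates := ⟨_, generates_diagSemigroup hq hpos, isBoundedAnalytic_diagSemigroup hq hpos⟩
  injective := injective_diagOp hpos
  denseRange := denseRange_diagOp hq hpos
  bound := by
    refine ⟨σ / 2, half_pos hσ0, half_lt_self hσ0, by linarith, isSectorial_diagOp hpos
      (half_pos hσ0), 1, fun φ hφ σ' hσ' hσ'σ => ?_⟩
    have hle : ∀ k, ‖φ (lam k)‖ ≤ ⨆ z : sector σ, ‖φ z‖ := fun k =>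
      le_ciSup hφ.bddAbove (⟨lam k, ofReal_mem_sector hσ0 (hpos k)⟩ : sector σ)
    rw [one_mul, mulCLM_ext ⟨_, hle⟩
      (hInftyApply_diagOp_apply hpos hφ hσ ((half_pos hσ0).trans hσ') hσ'σ)]
    exact norm_mulCLM_le hle

lemma hasBoundedHInftyCalculusOfAngle_zero_diagOp (hq : q < ∞) (hpos : ∀ k, 0 < lam k) :
    HasBoundedHInftyCalculusOfAngle (diagOp ℂ q lam) 0 := by
  have hπ := Real.pi_pos
  refine ⟨⟨1, hasBoundedHInftyCalculus_diagOp hq hpos one_pos (by linarith [Real.pi_gt_three])⟩,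
    fun σ hσ => hσ.pos.le, fun b hb => ?_⟩
  -- A positive lower bound `b` would exceed the admissible angle `min b 1 / 2`; the minimum keeps
  -- that angle below `π/2`.
  by_contra! h
  have h1 : 0 < min b 1 := lt_min h one_pos
  have h2 := hb (hasBoundedHInftyCalculus_diagOp hq hpos (half_pos h1)
    (by linarith [Real.pi_gt_three, min_le_right b 1]))
  linarith [min_le_left b 1]

end Sectorial

/-! ### The square root on finitely supported vectors -/

section SquareRootDiagonal

variable {q : ℝ≥0∞} {lam : ℕ → ℝ} {c : ℝ}

/-- This primitive evaluates the scalar Balakrishnan integral to `π √c`, which cancels the prefactor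
`1/π`. -/
lemma hasDerivAt_arctan_sqrt_div (hc : 0 < c) {t : ℝ} (ht : 0 < t) :
    HasDerivAt (fun t => 2 * √c * Real.arctan √(t / c)) (t ^ (-(1 / 2) : ℝ) * (c / (t + c))) t := by
  have h1 : HasDerivAt (fun t => √(t / c)) (1 / c / (2 * √(t / c))) t :=
    ((hasDerivAt_id t).div_const c).sqrt (by simp only [id]; positivity)
  refine (h1.arctan.const_mul (2 * √c)).congr_deriv ?_
  rw [Real.sq_sqrt (by positivity), Real.sqrt_div ht.le, Real.rpow_neg ht.le, ← Real.sqrt_eq_rpow]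
  have h2 : √c * √c = c := Real.mul_self_sqrt hc.le
  have h3 : 0 < √c := Real.sqrt_pos.2 hc
  have h4 : 0 < √t := Real.sqrt_pos.2 ht
  field_simp
  nlinarith

lemma tendsto_arctan_sqrt_div (hc : 0 < c) :
    Tendsto (fun t => 2 * √c * Real.arctan √(t / c)) atTop (𝓝 (Real.pi * √c)) := by
  have h1 : Tendsto (fun t => √(t / c)) atTop atTop :=
    Real.tendsto_sqrt_atTop.comp (tendsto_id.atTop_div_const hc)
  have h2 := ((Real.tendsto_arctan_atTop.mono_right nhdsWithin_le_nhds).comp h1).const_mul (2 * √c)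
  have h3 : 2 * √c * (Real.pi / 2) = Real.pi * √c := by ring
  rwa [h3] at h2

lemma continuous_arctan_sqrt_div : Continuous fun t => 2 * √c * Real.arctan √(t / c) :=
  continuous_const.mul (Real.continuous_arctan.comp (Real.continuous_sqrt.comp (by fun_prop)))

lemma integrableOn_balakrishnan (hc : 0 < c) :
    IntegrableOn (fun t : ℝ => t ^ (-(1 / 2) : ℝ) * (c / (t + c))) (Ioi 0) :=
  integrableOn_Ioi_deriv_of_nonneg continuous_arctan_sqrt_div.continuousWithinAt
    (fun t ht => hasDerivAt_arctan_sqrt_div hc ht)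
    (fun t ht => by
      have ht : 0 < t := ht
      positivity) (tendsto_arctan_sqrt_div hc)

lemma integral_balakrishnan (hc : 0 < c) :
    ∫ t in Ioi (0 : ℝ), t ^ (-(1 / 2) : ℝ) * (c / (t + c)) = Real.pi * √c := by
  rw [integral_Ioi_of_hasDerivAt_of_tendsto continuous_arctan_sqrt_div.continuousWithinAt
    (fun t ht => hasDerivAt_arctan_sqrt_div hc ht) (integrableOn_balakrishnan hc)
    (tendsto_arctan_sqrt_div hc)]
  simp

lemma memℓp_of_finite_support {J : Finset ℕ} {f : ℕ → ℝ} (hf : ∀ k ∉ J, f k = 0) :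
    Memℓp f q :=
  (memℓp_zero (J.finite_toSet.subset fun k hk => by
    by_contra h
    exact hk (hf k h))).of_exponent_ge zero_le

lemma eq_sum_single_of_finite_support {J : Finset ℕ} {y : ell ℝ q} (hy : ∀ k ∉ J, y k = 0) :
    y = ∑ k ∈ J, y k • lp.single q k (1 : ℝ) := by
  ext i
  rw [lp.coeFn_sum, Finset.sum_apply]
  simp only [lp.coeFn_smul, Pi.smul_apply, smul_eq_mul, lp.single_apply, Pi.single_apply, mul_ite,
    mul_one, mul_zero, Finset.sum_ite_eq]
  split_ifs with h
  · rfl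
  · exact hy i h

variable [Fact (1 ≤ q)]

lemma mem_domain_diagOp_of_finite_support {J : Finset ℕ} {x : ell ℝ q} (hx : ∀ k ∉ J, x k = 0) :
    x ∈ (diagOp ℝ q lam).domain := by
  rw [mem_domain_diagOp]
  exact memℓp_of_finite_support (J := J) fun k hk => by rw [hx k hk, mul_zero]

lemma balakrishnanIntegrand_diagOp_apply (hpos : ∀ k, 0 < lam k) (x : (diagOp ℝ q lam).domain)
    {t : ℝ} (ht : 0 < t) (k : ℕ) : balakrishnanIntegrand (diagOp ℝ q lam) x t k =
      t ^ (-(1 / 2) : ℝ) * (lam k / (t + lam k)) * (x : ell ℝ q) k := by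
  have hd : ∀ k, t ≤ ‖-t - (lam k : ℝ)‖ := fun k => by
    rw [Real.norm_eq_abs, abs_of_nonpos (by linarith [hpos k])]
    linarith [hpos k]
  have h1 : balakrishnanIntegrand (diagOp ℝ q lam) x t k = t ^ (-(1 / 2) : ℝ) *
      -(resolventOp (diagOp ℝ q lam) (-t) (diagOp ℝ q lam x) k) := rfl
  have h2 := resolventOp_diagOp (q := q) (lam := lam) (𝕜 := ℝ) ht hd
  have h3 : -t - lam k ≠ 0 := by linarith [hpos k]
  have h4 : t + lam k ≠ 0 := by linarith [hpos k]
  rw [h1, h2, mulCLM_apply ⟨_, isMultiplier_inv_sub ht hd⟩, diagOp_apply, mul_assoc]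
  congr 1
  change -((-t - lam k)⁻¹ * (lam k * _)) = _
  rw [show -t - lam k = -(t + lam k) by ring, inv_neg]
  ring

lemma integrableOn_balakrishnanIntegrand (hpos : ∀ k, 0 < lam k) {J : Finset ℕ}
    (x : (diagOp ℝ q lam).domain) (hx : ∀ k ∉ J, (x : ell ℝ q) k = 0) :
    IntegrableOn (balakrishnanIntegrand (diagOp ℝ q lam) x) (Ioi 0) := by
  have h : IntegrableOn (fun t : ℝ => ∑ k ∈ J, (t ^ (-(1 / 2) : ℝ) * (lam k / (t + lam k)) *
      (x : ell ℝ q) k) • lp.single q k (1 : ℝ)) (Ioi 0) :=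
    integrable_finsetSum _ fun k _ => ((integrableOn_balakrishnan (hpos k)).mul_const _).smul_const _
  refine h.congr_fun (fun t ht => ?_) measurableSet_Ioi
  have h1 : ∀ k ∉ J, balakrishnanIntegrand (diagOp ℝ q lam) x t k = 0 := fun k hk => by
    rw [balakrishnanIntegrand_diagOp_apply hpos x ht, hx k hk, mul_zero]
  rw [eq_sum_single_of_finite_support h1]
  refine Finset.sum_congr rfl fun k _ => ?_
  rw [balakrishnanIntegrand_diagOp_apply hpos x ht]

/-- Finite support is enough for the counterexample and reduces the vector-valued integral to
finitely many scalar ones, so the full domain of the closure need not be identified. -/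
lemma sqrtOp_diagOp_apply (hpos : ∀ k, 0 < lam k) {J : Finset ℕ} {x : ell ℝ q}
    (hx : ∀ k ∉ J, x k = 0) (k : ℕ) :
    applyOrZero (sqrtOp (diagOp ℝ q lam)) x k = √(lam k) * x k := by
  have hdom : x ∈ (diagOp ℝ q lam).domain := mem_domain_diagOp_of_finite_support hx
  have hint := integrableOn_balakrishnanIntegrand hpos ⟨x, hdom⟩ hx
  have hB : x ∈ (balakrishnanDomain (diagOp ℝ q lam)).map (diagOp ℝ q lam).domain.subtype :=
    ⟨⟨x, hdom⟩, hint, rfl⟩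
  have hval : applyOrZero (sqrtOp (diagOp ℝ q lam)) x =
      Real.pi⁻¹ • ∫ t in Ioi (0 : ℝ), balakrishnanIntegrand (diagOp ℝ q lam) ⟨x, hdom⟩ t := by
    -- Only the inclusion of the operator in its closure is used; it requires no proof of
    -- closability.
    have hle := LinearPMap.le_closure
      { domain := (balakrishnanDomain (diagOp ℝ q lam)).map (diagOp ℝ q lam).domain.subtype
        toFun :=
          { toFun := fun x =>
              balakrishnanMap (diagOp ℝ q lam)
                ⟨⟨x, (mem_map_balakrishnanDomain (diagOp ℝ q lam) x).1⟩,
                  (mem_map_balakrishnanDomain (diagOp ℝ q lam) x).2⟩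
            map_add' := fun x y => by
              rw [← map_add]
              rfl
            map_smul' := fun c x => by
              rw [RingHom.id_apply, ← map_smul]
              rfl } : ell ℝ q →ₗ.[ℝ] ell ℝ q }
    have hmem : x ∈ (sqrtOp (diagOp ℝ q lam)).domain := hle.1 hB
    rw [applyOrZero, dif_pos hmem]
    exact (hle.2 (x := ⟨x, hB⟩) (y := ⟨x, hmem⟩) rfl).symm
  rw [hval, lp.coeFn_smul, Pi.smul_apply, smul_eq_mul]
  have h1 := (lp.evalCLM ℝ (fun _ : ℕ => ℝ) q k).integral_comp_comm hint
  have h2 : (∫ t in Ioi (0 : ℝ), balakrishnanIntegrand (diagOp ℝ q lam) ⟨x, hdom⟩ t) k =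
      ∫ t in Ioi (0 : ℝ), t ^ (-(1 / 2) : ℝ) * (lam k / (t + lam k)) * x k := by
    refine h1.symm.trans (setIntegral_congr_fun measurableSet_Ioi fun t ht => ?_)
    exact balakrishnanIntegrand_diagOp_apply hpos ⟨x, hdom⟩ ht k
  rw [h2, integral_mul_const, integral_balakrishnan (hpos k)]
  have := Real.pi_ne_zero
  field_simp

end SquareRootDiagonal

/-! ### The Itô isometry for elementary integrals -/

section Isometry

lemma eLpNorm_two_sq {α E : Type*} [MeasurableSpace α] [NormedAddCommGroup E] {μ : Measure α}
    (f : α → E) : eLpNorm f 2 μ ^ 2 = ∫⁻ x, ‖f x‖ₑ ^ 2 ∂μ := by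
  have := eLpNorm_nnreal_pow_eq_lintegral (f := f) (μ := μ) (p := 2) two_ne_zero
  simpa using this

lemma eLpNorm_two_sq_eq_ofReal {α : Type*} [MeasurableSpace α] {μ : Measure α} {f : α → ℝ}
    (hf : MemLp f 2 μ) : eLpNorm f 2 μ ^ 2 = ENNReal.ofReal (∫ x, f x * f x ∂μ) := by
  rw [eLpNorm_two_sq, ofReal_integral_eq_lintegral_ofReal (f := fun x => f x * f x) (hf.integrable_mul hf)
    (ae_of_all _ fun x => mul_self_nonneg _)]
  refine lintegral_congr fun x => ?_
  rw [← abs_mul_abs_self, ENNReal.ofReal_mul (abs_nonneg _), ← Real.norm_eq_abs, ofReal_norm, sq]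

lemma integral_sum_mul_self {α ι : Type*} [MeasurableSpace α] [Fintype ι] {μ : Measure α}
    {X : ι → α → ℝ} (hX : ∀ i, MemLp (X i) 2 μ) (c : ι → ℝ) :
    ∫ x, (∑ i, c i * X i x) * (∑ i, c i * X i x) ∂μ =
      ∑ i, ∑ j, c i * c j * ∫ x, X i x * X j x ∂μ := by
  have hint : ∀ i j, Integrable (fun x => c i * c j * (X i x * X j x)) μ := fun i j =>
    ((hX i).integrable_mul (hX j)).const_mul _
  have hexp : ∀ x, (∑ i, c i * X i x) * (∑ i, c i * X i x) =
      ∑ i, ∑ j, c i * c j * (X i x * X j x) := fun x => by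
    rw [Finset.sum_mul_sum]
    exact Finset.sum_congr rfl fun i _ => Finset.sum_congr rfl fun j _ => mul_mul_mul_comm _ _ _ _
  simp_rw [hexp]
  rw [integral_finsetSum _ fun i _ => integrable_finsetSum _ fun j _ => hint i j]
  refine Finset.sum_congr rfl fun i _ => ?_
  rw [integral_finsetSum _ fun j _ => hint i j]
  exact Finset.sum_congr rfl fun j _ => integral_const_mul _ _

lemma memLp_sum_mul {α ι : Type*} [MeasurableSpace α] [Fintype ι] {μ : Measure α}
    {X : ι → α → ℝ} (hX : ∀ i, MemLp (X i) 2 μ) (c : ι → ℝ) :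
    MemLp (fun x => ∑ i, c i * X i x) 2 μ :=
  memLp_finsetSum _ fun i _ => (hX i).const_mul (c i)

/-- The `L²`-norm of a linear combination depends only on the Gram matrix of the family. -/
lemma eLpNorm_sum_mul_eq {α β ι : Type*} [MeasurableSpace α] [MeasurableSpace β] [Fintype ι]
    {μ : Measure α} {ν : Measure β} {X : ι → α → ℝ} {Y : ι → β → ℝ} (hX : ∀ i, MemLp (X i) 2 μ)
    (hY : ∀ i, MemLp (Y i) 2 ν)
    (h : ∀ i j, ∫ x, X i x * X j x ∂μ = ∫ y, Y i y * Y j y ∂ν) (c : ι → ℝ) :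
    eLpNorm (fun x => ∑ i, c i * X i x) 2 μ = eLpNorm (fun y => ∑ i, c i * Y i y) 2 ν := by
  have h1 : eLpNorm (fun x => ∑ i, c i * X i x) 2 μ ^ 2 =
      eLpNorm (fun y => ∑ i, c i * Y i y) 2 ν ^ 2 := by
    rw [eLpNorm_two_sq_eq_ofReal (memLp_sum_mul hX c), eLpNorm_two_sq_eq_ofReal (memLp_sum_mul hY c),
      integral_sum_mul_self hX, integral_sum_mul_self hY]
    simp_rw [h]
  exact (ENNReal.pow_right_strictMono two_ne_zero).injective h1

variable {Ω : Type*} [MeasurableSpace Ω] {P : Measure Ω} {W : ℝ≥0 → Ω → ℝ}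

lemma memLp_eval (hW : IsPreBrownianReal W P) (t : ℝ≥0) : MemLp (W t) 2 P :=
  (hW.isGaussianProcess.hasGaussianLaw_eval t).memLp_two

lemma memLp_increment (hW : IsPreBrownianReal W P) (a b : ℝ≥0) :
    MemLp (fun ω => W b ω - W a ω) 2 P :=
  (memLp_eval hW b).sub (memLp_eval hW a)

lemma memLp_indicator_Ioc (a b : ℝ) :
    MemLp ((Ioc a b).indicator fun _ => (1 : ℝ)) 2 (volume.restrict (Ioi 0)) :=
  memLp_indicator_const 2 measurableSet_Ioc 1 (Or.inr
    ((Measure.restrict_apply_le _ _).trans_lt measure_Ioc_lt_top).ne)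

/-- From the covariance `min s t` of Brownian motion, both sides are the length of `(a, b] ∩ (a',
b']`. Only second moments enter, neither independence nor path continuity. -/
lemma integral_increment_mul (hW : IsPreBrownianReal W P) {a b a' b' : ℝ≥0} (hab : a ≤ b)
    (hab' : a' ≤ b') :
    ∫ ω, (W b ω - W a ω) * (W b' ω - W a' ω) ∂P =
      ∫ s in Ioi (0 : ℝ), (Ioc (a : ℝ) b).indicator (fun _ => (1 : ℝ)) s *
        (Ioc (a' : ℝ) b').indicator (fun _ => (1 : ℝ)) s := by
  have : IsProbabilityMeasure P := hW.isGaussianProcess.isProbabilityMeasure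
  have hmean : ∀ a b : ℝ≥0, ∫ ω, (W b ω - W a ω) ∂P = 0 := fun a b => by
    rw [integral_sub (hW.integrable_eval b) (hW.integrable_eval a), hW.integral_eval,
      hW.integral_eval, sub_zero]
  have h1 : ∫ ω, (W b ω - W a ω) * (W b' ω - W a' ω) ∂P =
      cov[fun ω => W b ω - W a ω, fun ω => W b' ω - W a' ω; P] := by
    rw [covariance_eq_sub (memLp_increment hW a b) (memLp_increment hW a' b'), hmean, hmean, mul_zero,
      sub_zero]
    rfl
  have h2 : ∀ s : ℝ, (Ioc (a : ℝ) b).indicator (fun _ => (1 : ℝ)) s *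
      (Ioc (a' : ℝ) b').indicator (fun _ => (1 : ℝ)) s =
      (Ioc (max a a' : ℝ) (min b b')).indicator (fun _ => (1 : ℝ)) s := fun s => by
    rw [← Ioc_inter_Ioc, ← inter_indicator_mul]
    simp
  have h3 : Ioc (max a a' : ℝ) (min b b') ∩ Ioi 0 = Ioc (max a a' : ℝ) (min b b') :=
    inter_eq_left.2 fun s hs => (le_max_of_le_left a.2).trans_lt hs.1
  simp_rw [h2]
  rw [h1, covariance_fun_sub_fun_sub (memLp_eval hW _) (memLp_eval hW _) (memLp_eval hW _)
    (memLp_eval hW _), hW.covariance_fun_eval, hW.covariance_fun_eval, hW.covariance_fun_eval,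
    hW.covariance_fun_eval, integral_indicator_const _ measurableSet_Ioc, smul_eq_mul, mul_one,
    measureReal_restrict_apply measurableSet_Ioc, h3, Real.volume_real_Ioc]
  have ha : (a : ℝ) ≤ b := hab
  have ha' : (a' : ℝ) ≤ b' := hab'
  push_cast
  rcases le_total (a : ℝ) a' with h4 | h4 <;> rcases le_total (b : ℝ) b' with h5 | h5 <;>
    rcases le_total (a : ℝ) b' with h6 | h6 <;> rcases le_total (b : ℝ) a' with h7 | h7 <;>
    simp only [min_eq_left, min_eq_right, max_eq_left, max_eq_right, h4, h5, h6, h7] <;>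
    first
    | rw [max_eq_left (by linarith)]; linarith
    | rw [max_eq_right (by linarith)]; linarith

/-- The Itô isometry for elementary integrals. -/
lemma eLpNorm_sum_increment_eq (hW : IsPreBrownianReal W P) {ι : Type*} [Fintype ι] {a b : ι → ℝ≥0}
    (hab : ∀ i, a i ≤ b i) (c : ι → ℝ) :
    eLpNorm (fun ω => ∑ i, c i * (W (b i) ω - W (a i) ω)) 2 P =
      eLpNorm (fun s : ℝ => ∑ i, c i * (Ioc (a i : ℝ) (b i)).indicator (fun _ => (1 : ℝ)) s) 2
        (volume.restrict (Ioi 0)) :=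
  eLpNorm_sum_mul_eq (fun _ => memLp_increment hW _ _) (fun _ => memLp_indicator_Ioc _ _)
    (fun i j => integral_increment_mul hW (hab i) (hab j)) c

end Isometry

/-! ### Coordinates of stochastic integrals -/

section StepFunctions

variable {q : ℝ≥0∞} {Ω : Type*} {W : ℝ≥0 → Ω → ℝ}

lemma StepFun.integral_apply (Φ : StepFun (ell ℝ q)) (ω : Ω) (k : ℕ) :
    Φ.integral W ω k = ∑ i, Φ.x i k * (W (Φ.b i) ω - W (Φ.a i) ω) := by
  rw [StepFun.integral, lp.coeFn_sum, Finset.sum_apply]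
  refine Finset.sum_congr rfl fun i _ => ?_
  rw [lp.coeFn_smul, Pi.smul_apply, smul_eq_mul, mul_comm]

lemma StepFun.eval_apply (Φ : StepFun (ell ℝ q)) (s : ℝ) (k : ℕ) :
    Φ.eval s k = ∑ i, Φ.x i k * (Ioc (Φ.a i : ℝ) (Φ.b i)).indicator (fun _ => (1 : ℝ)) s := by
  rw [StepFun.eval, lp.coeFn_sum, Finset.sum_apply]
  refine Finset.sum_congr rfl fun i _ => ?_
  by_cases h : s ∈ Ioc (Φ.a i : ℝ) (Φ.b i)
  · rw [indicator_of_mem h, indicator_of_mem h, mul_one]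
  · rw [indicator_of_notMem h, indicator_of_notMem h, mul_zero]
    rfl

lemma StepFun.memLp_eval_apply (Φ : StepFun (ell ℝ q)) (k : ℕ) :
    MemLp (fun s => Φ.eval s k) 2 (volume.restrict (Ioi 0)) := by
  simp_rw [StepFun.eval_apply]
  exact memLp_sum_mul (fun _ => memLp_indicator_Ioc _ _) _

variable [MeasurableSpace Ω] {P : Measure Ω}

lemma StepFun.eLpNorm_integral_apply (hW : IsPreBrownianReal W P) (Φ : StepFun (ell ℝ q)) (k : ℕ) :
    eLpNorm (fun ω => Φ.integral W ω k) 2 P =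
      eLpNorm (fun s => Φ.eval s k) 2 (volume.restrict (Ioi 0)) := by
  simp_rw [StepFun.integral_apply, StepFun.eval_apply]
  exact eLpNorm_sum_increment_eq hW (fun i => (Φ.hab i).le) _

/-- The isometry is applied to the concatenation of both families of intervals, the coefficients of
`Ψ` with a minus sign. -/
lemma StepFun.eLpNorm_integral_sub_apply (hW : IsPreBrownianReal W P) (Φ Ψ : StepFun (ell ℝ q))
    (k : ℕ) :
    eLpNorm (fun ω => Φ.integral W ω k - Ψ.integral W ω k) 2 P =
      eLpNorm (fun s => Φ.eval s k - Ψ.eval s k) 2 (volume.restrict (Ioi 0)) := by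
  have h := eLpNorm_sum_increment_eq hW (ι := Fin Φ.n ⊕ Fin Ψ.n) (a := Sum.elim Φ.a Ψ.a)
    (b := Sum.elim Φ.b Ψ.b) (by
      rintro (i | i)
      · exact (Φ.hab i).le
      · exact (Ψ.hab i).le) (Sum.elim (fun i => Φ.x i k) fun i => -Ψ.x i k)
  simp only [Fintype.sum_sum_type, Sum.elim_inl, Sum.elim_inr, neg_mul, Finset.sum_neg_distrib,
    ← sub_eq_add_neg] at h
  simpa only [StepFun.integral_apply, StepFun.eval_apply] using h

variable [Fact (1 ≤ q)]

lemma StepFun.memLp_integral (hW : IsPreBrownianReal W P) (Φ : StepFun (ell ℝ q)) :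
    MemLp (Φ.integral W) 2 P :=
  memLp_finsetSum _ fun i _ =>
    (ContinuousLinearMap.toSpanSingleton ℝ (Φ.x i)).comp_memLp' (memLp_increment hW _ _)

lemma aestronglyMeasurable_apply {α : Type*} [MeasurableSpace α] {μ : Measure α} {f : α → ell ℝ q}
    (hf : AEStronglyMeasurable f μ) (k : ℕ) : AEStronglyMeasurable (fun x => f x k) μ :=
  (lp.evalCLM ℝ (fun _ : ℕ => ℝ) q k).continuous.comp_aestronglyMeasurable hf

lemma eLpNorm_apply_le {α : Type*} [MeasurableSpace α] {μ : Measure α} (f : α → ell ℝ q) (k : ℕ) :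
    eLpNorm (fun x => f x k) 2 μ ≤ eLpNorm f 2 μ :=
  eLpNorm_mono fun x => lp.norm_apply_le_norm exponent_ne_zero (f x) k

lemma eLpNorm_apply_le_squareFunctionNorm (hq : q < ∞) (F : ℝ → ell ℝ q) (k : ℕ) :
    eLpNorm (fun s => F s k) 2 (volume.restrict (Ioi 0)) ≤ squareFunctionNorm F := by
  have hp := exponent_toReal_pos hq
  have h1 : eLpNorm (fun s => F s k) 2 (volume.restrict (Ioi 0)) =
      ((∫⁻ s in Ioi (0 : ℝ), ‖F s k‖ₑ ^ 2) ^ (q.toReal / 2)) ^ (1 / q.toReal) := by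
    rw [← eLpNorm_two_sq, ← ENNReal.rpow_natCast, ← ENNReal.rpow_mul, ← ENNReal.rpow_mul]
    have : ((2 : ℕ) : ℝ) * (q.toReal / 2 * (1 / q.toReal)) = 1 := by
      push_cast
      field_simp
    rw [this, ENNReal.rpow_one]
  rw [h1, squareFunctionNorm]
  exact ENNReal.rpow_le_rpow (ENNReal.le_tsum k) (by positivity)

/-- Half of the Itô isometry, coordinatewise. -/
lemma IsStochIntegral.eLpNorm_apply_le (hq : q < ∞) (hW : IsPreBrownianReal W P)
    {F : ℝ → ell ℝ q} {X : Ω → ell ℝ q} (h : IsStochIntegral W P F X) (k : ℕ) :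
    eLpNorm (fun s => F s k) 2 (volume.restrict (Ioi 0)) ≤ eLpNorm (fun ω => X ω k) 2 P := by
  obtain ⟨hF, hX, Φ, h1, h2⟩ := h
  -- For each `n` the left side is at most `‖F_k - Φ_k‖ + ‖∫Φ_k dW‖`, and the last term is at most
  -- `‖X_k‖` plus an error. Both errors vanish in the limit, for any version `X` of the integral.
  have hlim : Tendsto (fun n => (squareFunctionNorm fun s => F s - (Φ n).eval s) +
      (eLpNorm (fun ω => X ω - (Φ n).integral W ω) 2 P + eLpNorm (fun ω => X ω k) 2 P)) atTop
      (𝓝 (0 + (0 + eLpNorm (fun ω => X ω k) 2 P))) := h1.add (h2.add tendsto_const_nhds)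
  rw [zero_add, zero_add] at hlim
  refine ge_of_tendsto' hlim fun n => ?_
  have hFk := aestronglyMeasurable_apply hF k
  have hXk := aestronglyMeasurable_apply hX k
  have hΦ := ((Φ n).memLp_eval_apply k).aestronglyMeasurable
  have hI := aestronglyMeasurable_apply ((Φ n).memLp_integral hW).aestronglyMeasurable k
  calc eLpNorm (fun s => F s k) 2 (volume.restrict (Ioi 0))
      = eLpNorm ((fun s => F s k - (Φ n).eval s k) + fun s => (Φ n).eval s k) 2
          (volume.restrict (Ioi 0)) := by
        congr 1
        funext s
        simp
    _ ≤ eLpNorm (fun s => F s k - (Φ n).eval s k) 2 (volume.restrict (Ioi 0)) +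
          eLpNorm (fun s => (Φ n).eval s k) 2 (volume.restrict (Ioi 0)) :=
        eLpNorm_add_le (hFk.sub hΦ) hΦ (by norm_num)
    _ ≤ (squareFunctionNorm fun s => F s - (Φ n).eval s) +
          eLpNorm (fun ω => (Φ n).integral W ω k) 2 P := by
        rw [(Φ n).eLpNorm_integral_apply hW]
        gcongr
        exact eLpNorm_apply_le_squareFunctionNorm hq (fun s => F s - (Φ n).eval s) k
    _ ≤ _ := by
        gcongr
        calc eLpNorm (fun ω => (Φ n).integral W ω k) 2 P
            = eLpNorm ((fun ω => X ω k) - fun ω => X ω k - (Φ n).integral W ω k) 2 P := by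
              congr 1
              funext ω
              simp
          _ ≤ eLpNorm (fun ω => X ω k) 2 P +
                eLpNorm (fun ω => X ω k - (Φ n).integral W ω k) 2 P :=
              eLpNorm_sub_le hXk (hXk.sub hI) (by norm_num)
          _ ≤ _ := by
              rw [add_comm]
              gcongr
              exact StochMaxReg.eLpNorm_apply_le (fun ω => X ω - (Φ n).integral W ω) k

end StepFunctions

/-! ### Existence of the stochastic integral for Lipschitz integrands with finite support -/

section Existence

lemma sum_indicator_Ioc {E : Type*} [AddCommMonoid E] {α : ℕ → ℝ} (hα : Monotone α) (f : ℝ → E)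
    (N : ℕ) (s : ℝ) : ∑ i ∈ Finset.range N, (Ioc (α i) (α (i + 1))).indicator f s =
      (Ioc (α 0) (α N)).indicator f s := by
  induction N with
  | zero => simp
  | succ n ih =>
    rw [Finset.sum_range_succ, ih, ← Ioc_union_Ioc_eq_Ioc (hα n.zero_le) (hα n.le_succ),
      indicator_union_of_disjoint (Ioc_disjoint_Ioc_of_le le_rfl)]

variable {q : ℝ≥0∞}

/-- The step function with values `f` at the right endpoints of `2 ^ n` intervals of equal length
partitioning `(0, m]`. -/
def dyadicStep {E : Type*} (f : ℝ → E) {m : ℝ≥0} (hm : 0 < m) (n : ℕ) : StepFun E where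
  n := 2 ^ n
  a i := m * i / 2 ^ n
  b i := m * (i + 1) / 2 ^ n
  hab i := by
    gcongr
    exact lt_add_one _
  x i := f (m * (i + 1) / 2 ^ n)

lemma norm_sub_dyadicStep_le {E : Type*} [NormedAddCommGroup E] {f : ℝ → E} {m : ℝ≥0} (hm : 0 < m)
    {L : ℝ} (hL0 : 0 ≤ L)
    (hL : ∀ s ∈ Ioc (0 : ℝ) m, ∀ s' ∈ Ioc (0 : ℝ) m, ‖f s - f s'‖ ≤ L * |s - s'|) (n : ℕ) (s : ℝ) :
    ‖(Ioc (0 : ℝ) m).indicator f s - (dyadicStep f hm n).eval s‖ ≤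
      (Ioc (0 : ℝ) m).indicator (fun _ => L * (m / 2 ^ n)) s := by
  set α : ℕ → ℝ := fun i => m * i / 2 ^ n with hα
  have hmono : Monotone α := fun i j hij => by
    simp only [hα]
    gcongr
  have h0 : α 0 = 0 := by simp [hα]
  have h1 : α (2 ^ n) = m := by
    simp only [hα]
    push_cast
    field_simp
  have hsplit : (Ioc (0 : ℝ) m).indicator f s =
      ∑ i ∈ Finset.range (2 ^ n), (Ioc (α i) (α (i + 1))).indicator f s := by
    rw [sum_indicator_Ioc hmono, h0, h1]
  have hsplit' : (Ioc (0 : ℝ) m).indicator (fun _ => L * (m / 2 ^ n)) s =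
      ∑ i ∈ Finset.range (2 ^ n),
        (Ioc (α i) (α (i + 1))).indicator (fun _ => L * ((m : ℝ) / 2 ^ n)) s := by
    rw [sum_indicator_Ioc hmono, h0, h1]
  have heval : (dyadicStep f hm n).eval s =
      ∑ i ∈ Finset.range (2 ^ n), (Ioc (α i) (α (i + 1))).indicator (fun _ => f (α (i + 1))) s := by
    rw [Finset.sum_range, StepFun.eval]
    refine Finset.sum_congr rfl fun i _ => ?_
    simp only [dyadicStep, hα]
    push_cast
    rfl
  rw [heval, hsplit, hsplit', ← Finset.sum_sub_distrib]
  refine (norm_sum_le _ _).trans (Finset.sum_le_sum fun i hi => ?_)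
  by_cases hs : s ∈ Ioc (α i) (α (i + 1))
  · rw [indicator_of_mem hs, indicator_of_mem hs, indicator_of_mem hs]
    have hi0 : 0 ≤ α i := h0 ▸ hmono i.zero_le
    have hi1 : α (i + 1) ≤ m := h1 ▸ hmono (Finset.mem_range.1 hi)
    have hdiff : α (i + 1) - α i = m / 2 ^ n := by
      simp only [hα]
      push_cast
      ring
    -- The right endpoint lies in `(0, m]` for every subinterval, whereas the left endpoint of the
    -- first one is `0`, where the Lipschitz bound is not assumed.
    refine (hL s ⟨hi0.trans_lt hs.1, hs.2.trans hi1⟩ _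
      ⟨hi0.trans_lt (hs.1.trans_le hs.2), hi1⟩).trans ?_
    gcongr
    rw [abs_of_nonpos (by linarith [hs.2])]
    linarith [hs.1]
  · rw [indicator_of_notMem hs, indicator_of_notMem hs, indicator_of_notMem hs, sub_zero, norm_zero]

variable [Fact (1 ≤ q)]

/-- With finitely many coordinates the triangle inequality reduces `L²(Ω; ℓ^q)` to scalar
`L²`-norms; a constant depending on `J` is harmless for existence. -/
lemma eLpNorm_le_sum_apply {α : Type*} [MeasurableSpace α] {μ : Measure α} {g : α → ell ℝ q}
    (hg : AEStronglyMeasurable g μ) {J : Finset ℕ} (hJ : ∀ x, ∀ k ∉ J, g x k = 0) :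
    eLpNorm g 2 μ ≤ ∑ k ∈ J, eLpNorm (fun x => g x k) 2 μ := by
  set u : ℕ → α → ell ℝ q := fun k x => g x k • lp.single q k (1 : ℝ) with hu
  have h1 : g = ∑ k ∈ J, u k := by
    funext x
    rw [Finset.sum_apply]
    exact eq_sum_single_of_finite_support (hJ x)
  have hum : ∀ k, AEStronglyMeasurable (u k) μ := fun k =>
    (aestronglyMeasurable_apply hg k).smul_const (lp.single q k (1 : ℝ) : ell ℝ q)
  have hun : ∀ k, eLpNorm (u k) 2 μ ≤ eLpNorm (fun x => g x k) 2 μ := fun k =>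
    eLpNorm_mono fun x => by
      rw [hu, norm_smul, lp.norm_single (pos_iff_ne_zero.2 exponent_ne_zero), norm_one, mul_one]
  calc eLpNorm g 2 μ = eLpNorm (∑ k ∈ J, u k) 2 μ := by rw [← h1]
    _ ≤ ∑ k ∈ J, eLpNorm (u k) 2 μ := eLpNorm_sum_le (fun k _ => hum k) (by norm_num)
    _ ≤ _ := Finset.sum_le_sum fun k _ => hun k

lemma squareFunctionNorm_le {J : Finset ℕ} {F : ℝ → ell ℝ q} (hq : q < ∞)
    (hJ : ∀ s, ∀ k ∉ J, F s k = 0)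
    {δ : ℝ≥0∞} (hδ : ∀ k, eLpNorm (fun s => F s k) 2 (volume.restrict (Ioi 0)) ≤ δ) :
    squareFunctionNorm F ≤ (∑ _k ∈ J, (δ ^ 2) ^ (q.toReal / 2)) ^ (1 / q.toReal) := by
  have hp := exponent_toReal_pos hq
  rw [squareFunctionNorm, tsum_eq_sum (s := J)]
  · refine ENNReal.rpow_le_rpow (Finset.sum_le_sum fun k _ => ?_) (by positivity)
    refine ENNReal.rpow_le_rpow ?_ (by positivity)
    rw [← eLpNorm_two_sq (fun s => F s k)]
    gcongr
    exact hδ k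
  · intro k hk
    simp only [hJ _ k hk, enorm_zero, ne_eq, OfNat.ofNat_ne_zero, not_false_eq_true, zero_pow,
      lintegral_zero]
    exact ENNReal.zero_rpow_of_pos (by positivity)

variable {Ω : Type*} [MeasurableSpace Ω] {P : Measure Ω} {W : ℝ≥0 → Ω → ℝ}

/-- A Lipschitz function on a bounded interval with finitely many nonzero coordinates is
stochastically integrable. -/
lemma stochIntegrable_indicator_of_lipschitz (hq : q < ∞) (hW : IsPreBrownianReal W P)
    {J : Finset ℕ} {f : ℝ → ell ℝ q} (hJ : ∀ s, ∀ k ∉ J, f s k = 0) {m : ℝ≥0} (hm : 0 < m) {L : ℝ}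
    (hL0 : 0 ≤ L)
    (hL : ∀ s ∈ Ioc (0 : ℝ) m, ∀ s' ∈ Ioc (0 : ℝ) m, ‖f s - f s'‖ ≤ L * |s - s'|) :
    StochIntegrable W P ((Ioc (0 : ℝ) m).indicator f) := by
  have hp := exponent_toReal_pos hq
  set F := (Ioc (0 : ℝ) m).indicator f with hF
  set Φ := dyadicStep f hm with hΦ
  have hFm : AEStronglyMeasurable F (volume.restrict (Ioi 0)) := by
    refine (aestronglyMeasurable_indicator_iff measurableSet_Ioc).2 ?_
    have : LipschitzOnWith ⟨L, hL0⟩ f (Ioc (0 : ℝ) m) :=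
      LipschitzOnWith.of_dist_le_mul fun s hs s' hs' => by
        rw [dist_eq_norm, dist_eq_norm]
        exact hL s hs s' hs'
    exact this.continuousOn.aestronglyMeasurable measurableSet_Ioc
  have hFJ : ∀ s, ∀ k ∉ J, F s k = 0 := fun s k hk => by
    rw [hF]
    by_cases hs : s ∈ Ioc (0 : ℝ) m
    · rw [indicator_of_mem hs, hJ s k hk]
    · rw [indicator_of_notMem hs]
      rfl
  have hxJ : ∀ n i, ∀ k ∉ J, (Φ n).x i k = 0 := fun n i k hk => hJ _ k hk
  have hevalJ : ∀ n s, ∀ k ∉ J, (Φ n).eval s k = 0 := fun n s k hk => by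
    rw [StepFun.eval_apply]
    exact Finset.sum_eq_zero fun i _ => by rw [hxJ n i k hk, zero_mul]
  have hintJ : ∀ n ω, ∀ k ∉ J, (Φ n).integral W ω k = 0 := fun n ω k hk => by
    rw [StepFun.integral_apply]
    exact Finset.sum_eq_zero fun i _ => by rw [hxJ n i k hk, zero_mul]
  -- The uniform error of the `n`-th step function is `L m 2^{-n}`, on an interval of length `m`;
  -- hence an `L²`-error of at most `K 2^{-n}` in each coordinate.
  set K : ℝ≥0∞ := ENNReal.ofReal (L * m) * (volume (Ioc (0 : ℝ) m)) ^ (1 / (2 : ℝ≥0∞).toReal) with hK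
  have hKtop : K ≠ ∞ := by
    refine ENNReal.mul_ne_top ENNReal.ofReal_ne_top (ENNReal.rpow_ne_top_of_nonneg (by positivity) ?_)
    exact measure_Ioc_lt_top.ne
  set r : ℝ≥0∞ := 2⁻¹ with hr
  have hrone : r < 1 := ENNReal.inv_lt_one.2 ENNReal.one_lt_two
  have hδ : ∀ n k, eLpNorm (fun s => F s k - (Φ n).eval s k) 2 (volume.restrict (Ioi 0)) ≤
      K * r ^ n := fun n k => by
    calc eLpNorm (fun s => F s k - (Φ n).eval s k) 2 (volume.restrict (Ioi 0))
        ≤ eLpNorm ((Ioc (0 : ℝ) m).indicator fun _ => L * (m / 2 ^ n)) 2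
            (volume.restrict (Ioi 0)) :=
          eLpNorm_mono_real fun s =>
            (lp.norm_apply_le_norm exponent_ne_zero (F s - (Φ n).eval s) k).trans
              (norm_sub_dyadicStep_le hm hL0 hL n s)
      _ ≤ ‖L * (m / 2 ^ n)‖ₑ *
            (volume.restrict (Ioi 0) (Ioc (0 : ℝ) m)) ^ (1 / (2 : ℝ≥0∞).toReal) :=
          eLpNorm_indicator_const_le _ _
      _ ≤ ENNReal.ofReal (L * (m / 2 ^ n)) *
            (volume (Ioc (0 : ℝ) m)) ^ (1 / (2 : ℝ≥0∞).toReal) := by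
          rw [Real.enorm_of_nonneg (by positivity)]
          gcongr
          exact Measure.restrict_le_self
      _ = K * r ^ n := by
          rw [hK, hr, ← mul_div_assoc, div_eq_mul_inv, ENNReal.ofReal_mul (by positivity),
            ENNReal.ofReal_inv_of_pos (by positivity), ENNReal.ofReal_pow zero_le_two,
            ENNReal.ofReal_ofNat, ENNReal.inv_pow]
          ring
  have hδlim : Tendsto (fun n => K * r ^ n) atTop (𝓝 0) := by
    have := ENNReal.Tendsto.const_mul (a := K)
      (ENNReal.tendsto_pow_atTop_nhds_zero_of_lt_one hrone) (Or.inr hKtop)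
    rwa [mul_zero] at this
  have hsq : Tendsto (fun n => squareFunctionNorm fun s => F s - (Φ n).eval s) atTop (𝓝 0) := by
    have h1 : Tendsto (fun n => (∑ _k ∈ J, ((K * r ^ n) ^ 2) ^ (q.toReal / 2)) ^ (1 / q.toReal)) atTop
        (𝓝 ((∑ _k ∈ J, ((0 : ℝ≥0∞) ^ 2) ^ (q.toReal / 2)) ^ (1 / q.toReal))) := by
      refine (ENNReal.continuous_rpow_const.tendsto _).comp (tendsto_finsetSum _ fun k _ => ?_)
      exact (ENNReal.continuous_rpow_const.tendsto _).comp
        (((ENNReal.continuous_pow 2).tendsto _).comp hδlim)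
    have h2 : (∑ _k ∈ J, ((0 : ℝ≥0∞) ^ 2) ^ (q.toReal / 2)) ^ (1 / q.toReal) = 0 := by
      rw [zero_pow two_ne_zero, ENNReal.zero_rpow_of_pos (by positivity), Finset.sum_const_zero,
        ENNReal.zero_rpow_of_pos (by positivity)]
    rw [h2] at h1
    refine tendsto_of_tendsto_of_tendsto_of_le_of_le tendsto_const_nhds h1 (fun _ => zero_le)
      fun n => squareFunctionNorm_le hq (fun s k hk => ?_) fun k => hδ n k
    rw [lp.coeFn_sub, Pi.sub_apply, hFJ s k hk, hevalJ n s k hk, sub_zero]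
  -- The completeness criterion asks for a strict inequality with a summable bound; the summand `1`
  -- provides strictness even if `J` is empty or `K = 0`.
  have hcauchy : ∀ N n n' : ℕ, N ≤ n → N ≤ n' →
      eLpNorm ((Φ n).integral W - (Φ n').integral W) 2 P < ((∑ _k ∈ J, 2 * K) + 1) * r ^ N :=
    fun N n n' hn hn' => by
      have hle : ∀ {i}, N ≤ i → K * r ^ i ≤ K * r ^ N := fun hi =>
        mul_le_mul' le_rfl (pow_le_pow_of_le_one zero_le hrone.le hi)
      have hcoord : ∀ k, eLpNorm (fun ω => ((Φ n).integral W - (Φ n').integral W) ω k) 2 P ≤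
          2 * K * r ^ N := fun k => by
        have hFk := aestronglyMeasurable_apply hFm k
        calc _ = eLpNorm (fun s => (Φ n).eval s k - (Φ n').eval s k) 2 (volume.restrict (Ioi 0)) :=
              StepFun.eLpNorm_integral_sub_apply hW (Φ n) (Φ n') k
          _ = eLpNorm ((fun s => F s k - (Φ n').eval s k) - fun s => F s k - (Φ n).eval s k) 2
                (volume.restrict (Ioi 0)) := by
              congr 1
              funext s
              simp
          _ ≤ K * r ^ n' + K * r ^ n :=
              (eLpNorm_sub_le (hFk.sub ((Φ n').memLp_eval_apply k).aestronglyMeasurable)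
                (hFk.sub ((Φ n).memLp_eval_apply k).aestronglyMeasurable) (by norm_num)).trans
                (add_le_add (hδ n' k) (hδ n k))
          _ ≤ K * r ^ N + K * r ^ N := add_le_add (hle hn') (hle hn)
          _ = _ := by ring
      have hsum : eLpNorm ((Φ n).integral W - (Φ n').integral W) 2 P ≤ (∑ _k ∈ J, 2 * K) * r ^ N := by
        rw [Finset.sum_mul]
        refine (eLpNorm_le_sum_apply (((Φ n).memLp_integral hW).sub
          ((Φ n').memLp_integral hW)).aestronglyMeasurable (J := J) fun ω k hk => ?_).trans
          (Finset.sum_le_sum fun k _ => hcoord k)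
        rw [Pi.sub_apply, lp.coeFn_sub, Pi.sub_apply, hintJ n ω k hk, hintJ n' ω k hk, sub_zero]
      refine hsum.trans_lt ?_
      rw [add_mul, one_mul]
      refine ENNReal.lt_add_right (ENNReal.mul_ne_top ?_ ?_) ?_
      · exact ENNReal.sum_ne_top.2 fun k _ => ENNReal.mul_ne_top ENNReal.ofNat_ne_top hKtop
      · exact ENNReal.pow_ne_top hrone.ne_top
      · exact pow_ne_zero _ (ENNReal.inv_ne_zero.2 ENNReal.ofNat_ne_top)
  have hBsum : ∑' N, ((∑ _k ∈ J, 2 * K) + 1) * r ^ N ≠ ∞ := by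
    rw [ENNReal.tsum_mul_left, ENNReal.tsum_geometric]
    refine ENNReal.mul_ne_top (ENNReal.add_ne_top.2 ⟨?_, ENNReal.one_ne_top⟩) ?_
    · exact ENNReal.sum_ne_top.2 fun k _ => ENNReal.mul_ne_top ENNReal.ofNat_ne_top hKtop
    · exact ENNReal.inv_ne_top.2 (tsub_pos_of_lt hrone).ne'
  obtain ⟨X, hX, hlim⟩ := Lp.cauchy_complete_eLpNorm (by norm_num)
    (fun n => (Φ n).memLp_integral hW) hBsum hcauchy
  refine ⟨X, hFm, hX.aestronglyMeasurable, Φ, hsq, hlim.congr fun n => ?_⟩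
  rw [eLpNorm_sub_comm]
  rfl

end Existence

/-! ### Failure of stochastic maximal regularity -/

section Counterexample

lemma abs_exp_neg_sub_exp_neg_le {a b : ℝ} (ha : 0 ≤ a) (hb : 0 ≤ b) :
    |Real.exp (-a) - Real.exp (-b)| ≤ |a - b| := by
  wlog h : a ≤ b generalizing a b
  · rw [abs_sub_comm, abs_sub_comm a]
    exact this hb ha (le_of_not_ge h)
  have h1 : Real.exp (-b) = Real.exp (-a) * Real.exp (-(b - a)) := by
    rw [← Real.exp_add]
    ring_nf
  have h2 := Real.add_one_le_exp (-(b - a))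
  have h3 : Real.exp (-a) ≤ 1 := Real.exp_le_one_iff.2 (by linarith)
  have h4 : Real.exp (-(b - a)) ≤ 1 := Real.exp_le_one_iff.2 (by linarith)
  rw [abs_of_nonpos (sub_nonpos.2 h), h1, abs_of_nonneg (by nlinarith [Real.exp_pos (-a)])]
  nlinarith [Real.exp_pos (-a)]

/-- Greedy choice from `λ_k → ∞`. The factor `2` is exactly what makes the windows `(1/λ_k, 2/λ_k]`
disjoint. -/
lemma exists_lacunary_finset {lam : ℕ → ℝ} (hpos : ∀ k, 0 < lam k) (htop : Tendsto lam atTop atTop)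
    (N : ℕ) : ∃ J : Finset ℕ, J.card = N ∧
      ∀ j ∈ J, ∀ k ∈ J, j ≠ k → 2 * lam j ≤ lam k ∨ 2 * lam k ≤ lam j := by
  obtain ⟨u, -, hu⟩ := exists_seq_of_forall_finset_exists (fun _ : ℕ => True)
    (fun j k => 2 * lam j ≤ lam k) fun s _ => by
      have : ∀ᶠ k in atTop, ∀ j ∈ s, 2 * lam j ≤ lam k :=
        (Finset.eventually_all s).2 fun j _ => htop.eventually_ge_atTop _
      obtain ⟨k, hk⟩ := this.exists
      exact ⟨k, trivial, hk⟩
  have hinj : Function.Injective u := fun m n hmn => by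
    by_contra h
    rcases lt_or_gt_of_ne h with h | h
    · have := hu m n h
      rw [hmn] at this
      linarith [hpos (u n)]
    · have := hu n m h
      rw [hmn] at this
      linarith [hpos (u n)]
  refine ⟨(Finset.range N).image u, ?_, ?_⟩
  · rw [Finset.card_image_of_injective _ hinj, Finset.card_range]
  · simp only [Finset.mem_image, forall_exists_index, and_imp]
    rintro _ m - rfl _ n - rfl hne
    have hmn : m ≠ n := fun h => hne (h ▸ rfl)
    rcases lt_or_gt_of_ne hmn with h | h
    · exact Or.inl (hu m n h)
    · exact Or.inr (hu n m h)

variable {q : ℝ≥0∞}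

/-- The element `∑_{k ∈ J} c_k e_k` of `ℓ^q`. -/
def finVec (q : ℝ≥0∞) (J : Finset ℕ) (c : ℕ → ℝ) : ell ℝ q := ∑ k ∈ J, lp.single q k (c k)

lemma finVec_apply (J : Finset ℕ) (c : ℕ → ℝ) (k : ℕ) :
    finVec q J c k = if k ∈ J then c k else 0 := by
  rw [finVec, lp.coeFn_sum, Finset.sum_apply]
  simp only [lp.single_apply, Pi.single_apply, Finset.sum_ite_eq]

variable [Fact (1 ≤ q)] {lam : ℕ → ℝ}

lemma norm_finVec_one (hq : q < ∞) (J : Finset ℕ) :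
    ‖finVec q J fun _ => 1‖ = (J.card : ℝ) ^ (1 / q.toReal) := by
  have hp := exponent_toReal_pos hq
  have h := lp.norm_sum_single hp (fun _ : ℕ => (1 : ℝ)) J
  simp only [norm_one, Real.one_rpow, Finset.sum_const, nsmul_eq_mul, mul_one] at h
  have h1 : ‖finVec q J fun _ => 1‖ ^ q.toReal = J.card := h
  rw [← h1, ← Real.rpow_mul (norm_nonneg _), mul_one_div_cancel hp.ne', Real.rpow_one]

lemma norm_finVec_sub_le (J : Finset ℕ) (c d : ℕ → ℝ) :
    ‖finVec q J c - finVec q J d‖ ≤ ∑ k ∈ J, |c k - d k| := by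
  rw [finVec, finVec, ← Finset.sum_sub_distrib]
  refine (norm_sum_le _ _).trans (Finset.sum_le_sum fun k _ => ?_)
  rw [← lp.single_sub, lp.norm_single (pos_iff_ne_zero.2 exponent_ne_zero), Real.norm_eq_abs]

lemma convIntegrand_indicator_finVec (hpos : ∀ k, 0 < lam k) (J : Finset ℕ) (ε t : ℝ) :
    convIntegrand (diagOp ℝ q lam) (diagSemigroup ℝ q lam)
      ((Ioc 0 ε).indicator fun _ => finVec q J fun _ => 1) t =
    (Ioc 0 (min t ε)).indicator
      fun s => finVec q J fun k => √(lam k) * Real.exp (-((t - s) * lam k)) := by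
  funext s
  rw [convIntegrand]
  by_cases hs : s ∈ Ioc 0 t
  · have hts : 0 ≤ t - s := sub_nonneg.2 hs.2
    rw [indicator_of_mem hs]
    by_cases hε : s ∈ Ioc 0 ε
    · have hmin : s ∈ Ioc 0 (min t ε) := ⟨hs.1, le_min hs.2 hε.2⟩
      rw [indicator_of_mem hε, indicator_of_mem hmin]
      have happly : ∀ k, diagSemigroup ℝ q lam (t - s) (finVec q J fun _ => 1) k =
          Real.exp (-((t - s) * lam k)) * finVec q J (fun _ => 1) k := fun k =>
        diagSemigroup_apply hpos hts _ k
      ext k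
      rw [sqrtOp_diagOp_apply hpos (J := J), happly, finVec_apply, finVec_apply]
      · split_ifs <;> ring
      · intro k hk
        rw [happly, finVec_apply, if_neg hk, mul_zero]
    · rw [indicator_of_notMem hε, indicator_of_notMem fun h => hε ⟨h.1, h.2.trans (min_le_right _ _)⟩,
        map_zero]
      ext k
      -- The zero vector is treated as a vector with empty support.
      rw [sqrtOp_diagOp_apply hpos (J := ∅) fun _ _ => rfl]
      exact mul_zero _
  · rw [indicator_of_notMem hs, indicator_of_notMem fun h => hs ⟨h.1, h.2.trans (min_le_left _ _)⟩]

variable {Ω : Type*} [MeasurableSpace Ω] {P : Measure Ω} {W : ℝ≥0 → Ω → ℝ}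

/-- Existence cannot be skipped: it is the condition defining the restricted class of `G`, and
without it `stochIntegral` could be its default value `0`, for which no lower bound holds. -/
lemma stochIntegrable_convIntegrand (hq : q < ∞) (hpos : ∀ k, 0 < lam k)
    (hW : IsPreBrownianReal W P) (J : Finset ℕ) {ε t : ℝ} (hε : 0 < ε) (ht : 0 < t) :
    StochIntegrable W P (convIntegrand (diagOp ℝ q lam) (diagSemigroup ℝ q lam)
      ((Ioc 0 ε).indicator fun _ => finVec q J fun _ => 1) t) := by
  rw [convIntegrand_indicator_finVec hpos]
  have hm : 0 < min t ε := lt_min ht hε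
  refine stochIntegrable_indicator_of_lipschitz hq hW (J := J) (m := ⟨min t ε, hm.le⟩)
    (L := ∑ k ∈ J, √(lam k) * lam k) (fun s k hk => ?_) hm
    (Finset.sum_nonneg fun k _ => mul_nonneg (Real.sqrt_nonneg _) (hpos k).le)
    fun s hs s' hs' => ?_
  · rw [finVec_apply, if_neg hk]
  · refine (norm_finVec_sub_le J _ _).trans ?_
    rw [Finset.sum_mul]
    refine Finset.sum_le_sum fun k _ => ?_
    have h1 : 0 ≤ t - s := sub_nonneg.2 (hs.2.trans (min_le_left t ε))
    have h2 : 0 ≤ t - s' := sub_nonneg.2 (hs'.2.trans (min_le_left t ε))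
    have h3 := abs_exp_neg_sub_exp_neg_le (mul_nonneg h1 (hpos k).le) (mul_nonneg h2 (hpos k).le)
    have h4 : (t - s) * lam k - (t - s') * lam k = -(lam k * (s - s')) := by ring
    rw [h4, abs_neg, abs_mul, abs_of_pos (hpos k)] at h3
    rw [← mul_sub, abs_mul, abs_of_nonneg (Real.sqrt_nonneg _), mul_assoc]
    gcongr

lemma isStochIntegral_stochIntegral {F : ℝ → ell ℝ q} (h : StochIntegrable W P F) :
    IsStochIntegral W P F (stochIntegral W P F) := by
  rw [stochIntegral, dif_pos h]
  exact h.choose_spec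

/-- The norm is bounded below by one coordinate, and that coordinate by its variance. As `(t - s)
λ_k ≤ t λ_k ≤ 2` throughout `(0, ε]`, the squared integrand is at least `λ_k e^{-4}` there. -/
lemma le_lintegral_stochIntegral (hq : q < ∞) (hpos : ∀ k, 0 < lam k)
    (hW : IsPreBrownianReal W P) {J : Finset ℕ} {ε t : ℝ} (hε : 0 < ε) {k : ℕ} (hk : k ∈ J)
    (hεk : ε ≤ 1 / lam k) (ht : t ∈ Ioc (1 / lam k) (2 / lam k)) :
    ENNReal.ofReal (lam k * Real.exp (-4)) * ENNReal.ofReal ε ≤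
      ∫⁻ ω, ‖stochIntegral W P (convIntegrand (diagOp ℝ q lam) (diagSemigroup ℝ q lam)
        ((Ioc 0 ε).indicator fun _ => finVec q J fun _ => 1) t) ω‖ₑ ^ 2 ∂P := by
  have hlk := hpos k
  have hεt : ε ≤ t := hεk.trans ht.1.le
  have ht0 : 0 < t := hε.trans_le hεt
  have hint := stochIntegrable_convIntegrand (q := q) hq hpos hW J hε ht0
  have h1 := (isStochIntegral_stochIntegral hint).eLpNorm_apply_le hq hW k
  have h2 := h1.trans (eLpNorm_apply_le _ k)
  rw [← eLpNorm_two_sq]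
  refine le_trans ?_ (pow_le_pow_left₀ zero_le h2 2)
  rw [eLpNorm_two_sq, convIntegrand_indicator_finVec hpos, min_eq_right hεt]
  calc ENNReal.ofReal (lam k * Real.exp (-4)) * ENNReal.ofReal ε
      = ∫⁻ _ in Ioc 0 ε, ENNReal.ofReal (lam k * Real.exp (-4)) := by
        rw [setLIntegral_const, Real.volume_Ioc, sub_zero]
    _ ≤ ∫⁻ s in Ioc 0 ε, ‖(Ioc 0 ε).indicator (fun s => finVec q J fun k =>
          √(lam k) * Real.exp (-((t - s) * lam k))) s k‖ₑ ^ 2 := by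
        refine setLIntegral_mono' measurableSet_Ioc fun s hs => ?_
        rw [indicator_of_mem hs, finVec_apply, if_pos hk, Real.enorm_of_nonneg (by positivity),
          ← ENNReal.ofReal_pow (by positivity)]
        refine ENNReal.ofReal_le_ofReal ?_
        rw [mul_pow, Real.sq_sqrt hlk.le, ← Real.exp_nat_mul]
        gcongr
        have h3 : t * lam k ≤ 2 := (le_div_iff₀ hlk).1 ht.2
        have h4 := mul_pos hs.1 hlk
        push_cast
        nlinarith
    _ ≤ _ := lintegral_mono_set Ioc_subset_Ioi_self

/-- The window of index `k` has length `1/λ_k`, which cancels the factor `λ_k` of the pointwise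
bound: all windows contribute the same amount. The outer integral is only bounded below over
disjoint measurable sets, so measurability in `t` plays no role. -/
lemma card_mul_le_lintegral (hq : q < ∞) (hpos : ∀ k, 0 < lam k)
    (hW : IsPreBrownianReal W P) {J : Finset ℕ}
    (hJ : ∀ j ∈ J, ∀ k ∈ J, j ≠ k → 2 * lam j ≤ lam k ∨ 2 * lam k ≤ lam j)
    {ε : ℝ} (hε : 0 < ε) (hεk : ∀ k ∈ J, ε ≤ 1 / lam k) :
    ENNReal.ofReal (J.card * Real.exp (-4) * ε) ≤
      ∫⁻ t in Ioi (0 : ℝ), ∫⁻ ω, ‖stochIntegral W P (convIntegrand (diagOp ℝ q lam)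
        (diagSemigroup ℝ q lam) ((Ioc 0 ε).indicator fun _ => finVec q J fun _ => 1) t) ω‖ₑ ^ 2
        ∂P := by
  set g : ℝ → ℝ≥0∞ := fun t => ∫⁻ ω, ‖stochIntegral W P (convIntegrand (diagOp ℝ q lam)
    (diagSemigroup ℝ q lam) ((Ioc 0 ε).indicator fun _ => finVec q J fun _ => 1) t) ω‖ₑ ^ 2 ∂P
    with hg
  have hdisj : Set.PairwiseDisjoint (J : Set ℕ) fun k => Ioc (1 / lam k) (2 / lam k) := by
    have haux : ∀ j k, 2 * lam j ≤ lam k →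
        Disjoint (Ioc (1 / lam k) (2 / lam k)) (Ioc (1 / lam j) (2 / lam j)) := fun j k h => by
      refine Ioc_disjoint_Ioc_of_le ?_
      rw [div_le_div_iff₀ (hpos k) (hpos j)]
      linarith
    intro j hj k hk hjk
    rcases hJ j hj k hk hjk with h | h
    · exact (haux j k h).symm
    · exact haux k j h
  have hterm : ∀ k ∈ J, ENNReal.ofReal (Real.exp (-4) * ε) ≤
      ∫⁻ t in Ioc (1 / lam k) (2 / lam k), g t := fun k hk => by
    have hlk := hpos k
    calc ENNReal.ofReal (Real.exp (-4) * ε)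
        = ∫⁻ _ in Ioc (1 / lam k) (2 / lam k),
            ENNReal.ofReal (lam k * Real.exp (-4)) * ENNReal.ofReal ε := by
          rw [setLIntegral_const, Real.volume_Ioc, ← ENNReal.ofReal_mul (by positivity),
            ← ENNReal.ofReal_mul (by positivity)]
          congr 1
          field_simp
          norm_num
      _ ≤ _ := setLIntegral_mono' measurableSet_Ioc fun t ht =>
          le_lintegral_stochIntegral hq hpos hW hε hk (hεk k hk) ht
  calc ENNReal.ofReal (J.card * Real.exp (-4) * ε)
      = ∑ _k ∈ J, ENNReal.ofReal (Real.exp (-4) * ε) := by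
        rw [Finset.sum_const, nsmul_eq_mul, mul_assoc, ENNReal.ofReal_mul (by positivity),
          ENNReal.ofReal_natCast]
    _ ≤ ∑ k ∈ J, ∫⁻ t in Ioc (1 / lam k) (2 / lam k), g t := Finset.sum_le_sum hterm
    _ = ∫⁻ t in ⋃ k ∈ J, Ioc (1 / lam k) (2 / lam k), g t :=
        (lintegral_biUnion_finset hdisj (fun _ _ => measurableSet_Ioc) _).symm
    _ ≤ _ := by
        refine lintegral_mono_set (iUnion₂_subset fun k _ t ht => ?_)
        exact (one_div_pos.2 (hpos k)).trans ht.1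

lemma lintegral_indicator_finVec (hq : q < ∞) (J : Finset ℕ) (ε : ℝ) :
    ∫⁻ t in Ioi (0 : ℝ), ‖(Ioc 0 ε).indicator (fun _ => finVec q J fun _ => 1) t‖ₑ ^ 2 ≤
      ENNReal.ofReal ((J.card : ℝ) ^ (2 / q.toReal)) * ENNReal.ofReal ε := by
  have h1 : ∀ t, ‖(Ioc 0 ε).indicator (fun _ => finVec q J fun _ => 1) t‖ₑ ^ 2 =
      (Ioc 0 ε).indicator (fun _ => ENNReal.ofReal ((J.card : ℝ) ^ (2 / q.toReal))) t := fun t => by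
    by_cases ht : t ∈ Ioc 0 ε
    · rw [indicator_of_mem ht, indicator_of_mem ht, ← ofReal_norm, norm_finVec_one hq,
        ← ENNReal.ofReal_pow (by positivity), ← Real.rpow_natCast, ← Real.rpow_mul (by positivity)]
      congr 2
      push_cast
      ring
    · rw [indicator_of_notMem ht, indicator_of_notMem ht, enorm_zero, zero_pow two_ne_zero]
  simp_rw [h1]
  rw [lintegral_indicator_const measurableSet_Ioc]
  gcongr
  refine (Measure.restrict_apply_le _ _).trans ?_
  rw [Real.volume_Ioc, sub_zero]

lemma not_stochastic_maximal_regularity (hq2 : 2 < q) (hq : q < ∞) (hpos : ∀ k, 0 < lam k)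
    (htop : Tendsto lam atTop atTop) (hW : IsPreBrownianReal W P) :
    ¬ ∃ C : ℝ, ∀ G : ℝ → ell ℝ q,
      MemLp G 2 (volume.restrict (Ioi 0)) →
      (∀ t : ℝ, 0 < t → StochIntegrable W P
        (convIntegrand (diagOp ℝ q lam) (diagSemigroup ℝ q lam) G t)) →
      ∫⁻ t in Ioi (0 : ℝ), ∫⁻ ω, ‖stochIntegral W P
          (convIntegrand (diagOp ℝ q lam) (diagSemigroup ℝ q lam) G t) ω‖ₑ ^ 2 ∂P
        ≤ ENNReal.ofReal (C ^ 2) * ∫⁻ t in Ioi (0 : ℝ), ‖G t‖ₑ ^ 2 := by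
  rintro ⟨C, hC⟩
  have hp := exponent_toReal_pos hq
  have hp2 : 2 < q.toReal := by
    have := (ENNReal.toReal_lt_toReal ENNReal.ofNat_ne_top hq.ne).2 hq2
    simpa using this
  -- The assumed estimate reads `N e^{-4} ε ≤ C² N^{2/q} ε`. The length `ε` cancels, so it may
  -- depend on `J` without any control.
  have hbound : ∀ N : ℕ, 0 < N → (N : ℝ) ^ (1 - 2 / q.toReal) ≤ C ^ 2 * Real.exp 4 := fun N hN => by
    obtain ⟨J, hcard, hJ⟩ := exists_lacunary_finset hpos htop N
    obtain ⟨ε, hε, hεk⟩ : ∃ ε : ℝ, 0 < ε ∧ ∀ k ∈ J, ε ≤ 1 / lam k := by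
      have h : ∀ᶠ ε in 𝓝[>] (0 : ℝ), ∀ k ∈ J, ε ≤ 1 / lam k :=
        (Finset.eventually_all J).2 fun k _ =>
          ((eventually_lt_nhds (one_div_pos.2 (hpos k))).filter_mono nhdsWithin_le_nhds).mono
            fun _ h => h.le
      obtain ⟨ε, h1, h2⟩ := (h.and self_mem_nhdsWithin).exists
      exact ⟨ε, h2, h1⟩
    have hG : MemLp ((Ioc 0 ε).indicator fun _ => finVec q J fun _ => (1 : ℝ)) 2
        (volume.restrict (Ioi 0)) :=
      memLp_indicator_const 2 measurableSet_Ioc _ (Or.inr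
        ((Measure.restrict_apply_le _ _).trans_lt measure_Ioc_lt_top).ne)
    have h1 := (card_mul_le_lintegral hq hpos hW hJ hε hεk).trans ((hC _ hG fun t ht =>
      stochIntegrable_convIntegrand hq hpos hW J hε ht).trans
        (mul_le_mul' le_rfl (lintegral_indicator_finVec hq J ε)))
    rw [← ENNReal.ofReal_mul (by positivity), ← ENNReal.ofReal_mul (by positivity),
      ENNReal.ofReal_le_ofReal_iff (by positivity), ← mul_assoc, hcard] at h1
    have h2 := le_of_mul_le_mul_right h1 hε
    have hN0 : (0 : ℝ) < N := by exact_mod_cast hN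
    rw [Real.rpow_sub hN0, Real.rpow_one, div_le_iff₀ (by positivity)]
    calc (N : ℝ) = N * Real.exp (-4) * Real.exp 4 := by
          rw [mul_assoc, ← Real.exp_add]
          simp
      _ ≤ C ^ 2 * (N : ℝ) ^ (2 / q.toReal) * Real.exp 4 := by gcongr
      _ = _ := by ring
  have hexp : 0 < 1 - 2 / q.toReal := sub_pos.2 ((div_lt_one hp).2 hp2)
  have hlim := (tendsto_rpow_atTop hexp).comp tendsto_natCast_atTop_atTop
  obtain ⟨N, h1, h2⟩ := ((hlim.eventually_gt_atTop (C ^ 2 * Real.exp 4)).and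
    (eventually_gt_atTop 0)).exists
  exact absurd (hbound N h2) (not_le.2 h1)

end Counterexample

end StochMaxReg

end

theorem mainTheorem5 (q : ℝ≥0∞) [Fact (1 ≤ q)] (hq : 2 < q) (hq' : q < ∞)
    (lam : ℕ → ℝ) (hpos : ∀ k, 0 < lam k) (hmono : StrictMono lam)
    (htop : Tendsto lam atTop atTop) :
    StochMaxReg.HasBoundedHInftyCalculusOfAngle (StochMaxReg.diagOp ℂ q lam) 0 ∧
    ∃ S : ℝ → StochMaxReg.ell ℝ q →L[ℝ] StochMaxReg.ell ℝ q,
      StochMaxReg.Generates (-(StochMaxReg.diagOp ℝ q lam)) S ∧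
      ∀ (Ω : Type*) [MeasurableSpace Ω] (P : Measure Ω) (W : ℝ≥0 → Ω → ℝ),
        IsPreBrownianReal W P →
        ¬ ∃ C : ℝ, ∀ G : ℝ → StochMaxReg.ell ℝ q,
          MemLp G 2 (volume.restrict (Ioi 0)) →
          (∀ t : ℝ, 0 < t → StochMaxReg.StochIntegrable W P
            (StochMaxReg.convIntegrand (StochMaxReg.diagOp ℝ q lam) S G t)) →
          ∫⁻ t in Ioi (0 : ℝ), ∫⁻ ω, ‖StochMaxReg.stochIntegral W P
              (StochMaxReg.convIntegrand (StochMaxReg.diagOp ℝ q lam) S G t) ω‖ₑ ^ 2 ∂P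
            ≤ ENNReal.ofReal (C ^ 2) * ∫⁻ t in Ioi (0 : ℝ), ‖G t‖ₑ ^ 2 :=
  ⟨StochMaxReg.hasBoundedHInftyCalculusOfAngle_zero_diagOp hq' hpos,
    StochMaxReg.diagSemigroup ℝ q lam, StochMaxReg.generates_diagSemigroup hq' hpos,
    fun _ _ _ _ hW => StochMaxReg.not_stochastic_maximal_regularity hq hq' hpos htop hW⟩
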